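/- Fix an integer $d\ge 1$. There are an algorithm and a polynomial $p$ (both may depend on $d$) such that the following holds for every $n\ge 1$ and all full-dimensional polytopes $\mathcal{P}_i=\{x\in\mathbb{R}^d : A^i x\le b^i\}$, $i=0,1,\dots,n$, given by rational matrices $A^i$ and rational vectors $b^i$. Let $\mathbf{e}_0:=0\in\mathbb{R}^n$, let $\mathbf{e}_1,\dots,\mathbf{e}_n$ be the standard unit vectors of $\mathbb{R}^n$, and let $$\mathcal{D}:=\operatorname{conv}\bigcup_{i=0}^n\left\{\binom{x}{\mathbf{e}_i} : x\in\mathcal{P}_i\right\}\subset\mathbb{R}^{d+n}.$$ Given the systems $A^ix\le b^i$, $i=0,\dots,n$, the algorithm computes, in time at most $p$ of the input size (bit complexity, with numbers encoded in binary), a facet-describing system of linear inequalities $\alpha^\top x+\mu^\top z\le\rho$ with integer coefficients for $\mathcal{D}$: every inequality of the system is valid for $\mathcal{D}$ and describes a facet of $\mathcal{D}$, every facet of $\mathcal{D}$ is described by exactly one inequality of the system, and the solution set of the system is $\mathcal{D}$. -/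

import Mathlib

namespace DisjHull

/-! ## Polytopes, faces, facets -/

section Polyhedral

variable {E : Type*} [AddCommGroup E] [Module ℝ E]

open Classical in
/-- The (affine) dimension of a set; the empty set has dimension `-1`. -/
noncomputable def polyDim (S : Set E) : ℤ :=
  if S = ∅ then -1 else (Module.finrank ℝ (vectorSpan ℝ S) : ℤ)

/-- The inequality `f x ≤ β` is valid for `S`. -/
def Valid (S : Set E) (f : E →ₗ[ℝ] ℝ) (β : ℝ) : Prop :=
  ∀ x ∈ S, f x ≤ β

/-- The subset of `S` described by `f x ≤ β`. -/
def face (S : Set E) (f : E →ₗ[ℝ] ℝ) (β : ℝ) : Set E :=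
  {x ∈ S | f x = β}

/-- The inequality `f x ≤ β` is valid for `S` and the face it describes is a facet of `S`. -/
def DescribesFacet (S : Set E) (f : E →ₗ[ℝ] ℝ) (β : ℝ) : Prop :=
  Valid S f β ∧ polyDim (face S f β) = polyDim S - 1

/-- `F` is a facet of `S`. -/
def IsFacet (S F : Set E) : Prop :=
  ∃ (f : E →ₗ[ℝ] ℝ) (β : ℝ), DescribesFacet S f β ∧ face S f β = F

end Polyhedral

/-! ## The disjunction hull -/

/-- Rational inequality systems `A i x ≤ b i` in `d` variables, for `i = 0, …, n`. -/
structure Input (d n : ℕ) where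
  m : Fin (n + 1) → ℕ
  A : (i : Fin (n + 1)) → Matrix (Fin (m i)) (Fin d) ℚ
  b : (i : Fin (n + 1)) → Fin (m i) → ℚ

variable {d n : ℕ}

/-- The polyhedron `P i = {x ∈ ℝ^d : A i x ≤ b i}`. -/
def Input.P (I : Input d n) (i : Fin (n + 1)) : Set (Fin d → ℝ) :=
  {x | ∀ k, ∑ j, (I.A i k j : ℝ) * x j ≤ (I.b i k : ℝ)}

/-- `e 0 = 0`, and `e 1, …, e n` are the standard unit vectors of `ℝ^n`. -/
def unitVec (n : ℕ) : Fin (n + 1) → Fin n → ℝ :=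
  Fin.cases 0 (fun j => Pi.single j 1)

/-- The convex hull of the lifted sets `{(x, e i) : x ∈ P i}` in `ℝ^d × ℝ^n = ℝ^(d+n)`. -/
def Input.D (I : Input d n) : Set ((Fin d → ℝ) × (Fin n → ℝ)) :=
  convexHull ℝ (⋃ i : Fin (n + 1), (fun x => (x, unitVec n i)) '' I.P i)

/-- An inequality `∑ j, α j * x j + ∑ i, μ i * z i ≤ ρ` with integer coefficients. -/
structure Ineq (d n : ℕ) where
  α : Fin d → ℤ
  μ : Fin n → ℤ
  ρ : ℤ

/-- The left-hand side `(x, z) ↦ ∑ j, α j * x j + ∑ i, μ i * z i`. -/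
noncomputable def Ineq.lhs (r : Ineq d n) : (Fin d → ℝ) × (Fin n → ℝ) →ₗ[ℝ] ℝ :=
  (∑ j, (r.α j : ℝ) • LinearMap.proj j) ∘ₗ LinearMap.fst ℝ (Fin d → ℝ) (Fin n → ℝ) +
    (∑ i, (r.μ i : ℝ) • LinearMap.proj i) ∘ₗ LinearMap.snd ℝ (Fin d → ℝ) (Fin n → ℝ)

/-- A facet-describing inequality system for `S`: every inequality describes a facet, every facet
is described by an inequality of the system, no facet is described twice, and the solution set of
the system is `S`. -/
structure IsFacetSystem (S : Set ((Fin d → ℝ) × (Fin n → ℝ))) (R : List (Ineq d n)) : Prop where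
  describes : ∀ r ∈ R, DescribesFacet S r.lhs (r.ρ : ℝ)
  complete : ∀ F, IsFacet S F → ∃ r ∈ R, face S r.lhs (r.ρ : ℝ) = F
  irredundant : R.Pairwise fun r r' => face S r.lhs (r.ρ : ℝ) ≠ face S r'.lhs (r'.ρ : ℝ)
  solutions : {p | ∀ r ∈ R, r.lhs p ≤ (r.ρ : ℝ)} = S

/-! ## Model of computation

Programs of a small while-language act on binary trees whose leaves are integers. Every step is
charged the bit size of the data it reads and writes (and a multiplication the product of the
bit sizes of its two factors), so that running times are bit complexities: up to a polynomial they
agree with those of Turing machines. -/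

/-- Data: binary trees with integer leaves. -/
inductive Val where
  | int (z : ℤ)
  | pair (a b : Val)

/-- The size of a datum: integers are written in binary. -/
def Val.size : Val → ℕ
  | .int z => z.natAbs.size + 1
  | .pair a b => a.size + b.size + 1

/-- Primitive operations. -/
inductive Op where
  | id | fst | snd | isPair | add | sub | mul | le
  | const (z : ℤ)

/-- The effect of the primitive operations; on ill-formed arguments the result is `0`. -/
def Op.run : Op → Val → Val
  | .id, v => v
  | .fst, .pair a _ => a
  | .snd, .pair _ b => b
  | .isPair, .pair _ _ => .int 1
  | .add, .pair (.int x) (.int y) => .int (x + y)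
  | .sub, .pair (.int x) (.int y) => .int (x - y)
  | .mul, .pair (.int x) (.int y) => .int (x * y)
  | .le, .pair (.int x) (.int y) => .int (if x ≤ y then 1 else 0)
  | .const z, _ => .int z
  | _, _ => .int 0

/-- The cost of a primitive operation. -/
def Op.cost : Op → Val → ℕ
  | .mul, .pair a b => a.size * b.size + (Val.pair a b).size + (Op.run .mul (.pair a b)).size
  | o, v => v.size + (o.run v).size

/-- Programs. `comp f g` runs `g` and then `f`; `pair f g` runs `f` and `g` on the same input and
pairs the results; `ite c f g` runs `f` or `g` according to whether `c` returns a nonzero value or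
`0`; `loop c f` is the loop `while c do f`. -/
inductive Prog where
  | op (o : Op)
  | comp (f g : Prog)
  | pair (f g : Prog)
  | ite (c f g : Prog)
  | loop (c f : Prog)

/-- `Runs p v w t`: on input `v` the program `p` halts with output `w`, at total cost `t`. -/
inductive Runs : Prog → Val → Val → ℕ → Prop where
  | op (o : Op) (v : Val) : Runs (.op o) v (o.run v) (o.cost v)
  | comp {f g : Prog} {u v w : Val} {s t : ℕ} :
      Runs g u v s → Runs f v w t → Runs (.comp f g) u w (s + t + 1)
  | pair {f g : Prog} {v a b : Val} {s t : ℕ} :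
      Runs f v a s → Runs g v b t → Runs (.pair f g) v (.pair a b) (s + t + v.size + 1)
  | ite_true {c f g : Prog} {v a w : Val} {s t : ℕ} :
      Runs c v a s → a ≠ .int 0 → Runs f v w t → Runs (.ite c f g) v w (s + t + v.size + 1)
  | ite_false {c f g : Prog} {v w : Val} {s t : ℕ} :
      Runs c v (.int 0) s → Runs g v w t → Runs (.ite c f g) v w (s + t + v.size + 1)
  | loop_stop {c f : Prog} {v : Val} {s : ℕ} :
      Runs c v (.int 0) s → Runs (.loop c f) v v (s + v.size + 1)
  | loop_step {c f : Prog} {v a u w : Val} {s t r : ℕ} :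
      Runs c v a s → a ≠ .int 0 → Runs f v u t → Runs (.loop c f) u w r →
      Runs (.loop c f) v w (s + t + r + v.size + 1)

/-! ## Encodings -/

/-- Lists are encoded as right-nested pairs that end in `0`. -/
def Val.ofList : List Val → Val
  | [] => .int 0
  | a :: l => .pair a (Val.ofList l)

/-- The encoding of a tuple. -/
def Val.ofTuple {k : ℕ} (f : Fin k → Val) : Val :=
  Val.ofList (List.ofFn f)

/-- A rational number is encoded by its numerator and denominator in lowest terms. -/
def Val.ofRat (q : ℚ) : Val :=
  .pair (.int q.num) (.int (q.den : ℤ))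

/-- The encoding of the input: the list of the `n + 1` systems, each of which is the list of its
rows; a row is encoded by its list of coefficients and its right-hand side. -/
def Input.encode (I : Input d n) : Val :=
  Val.ofTuple fun i => Val.ofTuple fun k =>
    .pair (Val.ofTuple fun j => Val.ofRat (I.A i k j)) (Val.ofRat (I.b i k))

/-- The encoding of an inequality: its two lists of coefficients and its right-hand side. -/
def Ineq.encode (r : Ineq d n) : Val :=
  .pair (Val.ofTuple fun j => .int (r.α j))
    (.pair (Val.ofTuple fun i => .int (r.μ i)) (.int r.ρ))

end DisjHull

namespace DisjHull

/-! ## Polynomial-time functions between encoded types -/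

/-! Put `μ 0 = 0`. Over `e i` the inequality `α·x + μ·z ≤ ρ` reads `α·x + μ i ≤ ρ`, so a facet of
the hull is governed by the layers it meets. If it misses the layer of `P i`, then nonnegativity of
the `i`-th barycentric coordinate of `z` (`simplexIneq`) is tight on it, and so is its inequality up
to a positive factor. If it meets every layer, then `ρ = h 0` and `μ i = h 0 - h i`, where `h i` is
the maximum of `α` over `P i` (`normalIneq`). Being a facet then means that the differences of
maximizers of `α`, taken within each `P i`, span the hyperplane orthogonal to `α`. Equivalently, `α`
is a facet normal of the Minkowski sum of the `P i` (the Cayley trick).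

Hence `α` is a multiple of a generalized cross product of `d - 1` differences, each of two vertices
of one polytope. For fixed `d` there are polynomially many candidates; the algorithm lists them with
both signs, keeps those maximized at the chosen points, and removes repeated directions. Likewise a
vertex, in homogeneous coordinates, is a cross product of `d` tight rows. Both facts rest on
`exists_cross_eq_smul`; `describesFacet_of_mem_normals` and `exists_mem_facetSystem` show that the
resulting inequalities are exactly the facets up to positive factors.

That the facets cut out the hull is `exists_describesFacet_lt`: a point outside is cut off by an
extreme point of the polar body (Krein–Milman), and extreme points of the polar body describe
facets.

For the running time, `PolyTime` is closed under composition, pairing, branching and folds whose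
accumulators stay polynomially small (`PolyTime.foldl`). With `d` fixed, tuples and determinants
have fixed shape, and `n` enters only as a list length, so a single program serves all `n`. -/

/-- Types whose elements are encoded as data. -/
class Enc (α : Type) where
  enc : α → Val

open Enc

instance : Enc ℤ := ⟨Val.int⟩

instance : Enc Bool := ⟨fun b => .int (if b then 1 else 0)⟩

instance : Enc ℚ := ⟨Val.ofRat⟩

section

variable {α β γ δ σ : Type} [Enc α] [Enc β] [Enc γ] [Enc δ] [Enc σ]

instance : Enc (α × β) := ⟨fun x => .pair (enc x.1) (enc x.2)⟩

instance : Enc (List α) := ⟨fun l => Val.ofList (l.map enc)⟩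

instance {k : ℕ} : Enc (Fin k → α) := ⟨fun f => Val.ofTuple fun j => enc (f j)⟩

theorem Val.one_le_size (v : Val) : 1 ≤ v.size := by
  cases v <;> simp [Val.size]

theorem eval_mono (P : Polynomial ℕ) {a b : ℕ} (h : a ≤ b) : P.eval a ≤ P.eval b := by
  rw [Polynomial.eval_eq_sum_range, Polynomial.eval_eq_sum_range]
  gcongr

/-- Every rule charges for what it writes. Polynomial time therefore bounds output sizes
polynomially, which is what makes composition work. -/
theorem Runs.size_le {p : Prog} {v w : Val} {t : ℕ} (h : Runs p v w t) : w.size ≤ t := by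
  induction h with
  | op o v =>
    unfold Op.cost
    split <;> omega
  | comp | pair | ite_true | ite_false | loop_stop | loop_step =>
    try simp only [Val.size] at *
    omega

/-- `f` is bounded by a polynomial in the size of the encoding of its argument. -/
def PolyBound (f : α → ℕ) : Prop :=
  ∃ P : Polynomial ℕ, ∀ a, f a ≤ P.eval (enc a).size

namespace PolyBound

theorem mono {f g : α → ℕ} (hg : PolyBound g) (h : ∀ a, f a ≤ g a) : PolyBound f := by
  obtain ⟨P, hP⟩ := hg
  exact ⟨P, fun a => (h a).trans (hP a)⟩

theorem const (c : ℕ) : PolyBound fun _ : α => c :=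
  ⟨Polynomial.C c, fun _ => by simp⟩

theorem size : PolyBound fun a : α => (enc a).size :=
  ⟨Polynomial.X, fun _ => by simp⟩

theorem add {f g : α → ℕ} (hf : PolyBound f) (hg : PolyBound g) :
    PolyBound fun a => f a + g a := by
  obtain ⟨P, hP⟩ := hf
  obtain ⟨Q, hQ⟩ := hg
  exact ⟨P + Q, fun a => by simpa using add_le_add (hP a) (hQ a)⟩

theorem mul {f g : α → ℕ} (hf : PolyBound f) (hg : PolyBound g) :
    PolyBound fun a => f a * g a := by
  obtain ⟨P, hP⟩ := hf
  obtain ⟨Q, hQ⟩ := hg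
  exact ⟨P * Q, fun a => by simpa using Nat.mul_le_mul (hP a) (hQ a)⟩

theorem eval {f : α → ℕ} (hf : PolyBound f) (Q : Polynomial ℕ) :
    PolyBound fun a => Q.eval (f a) := by
  obtain ⟨P, hP⟩ := hf
  exact ⟨Q.comp P, fun a => by simpa using eval_mono Q (hP a)⟩

end PolyBound

/-- `f` is computed on encodings by a program that runs in polynomial time. -/
@[fun_prop]
def PolyTime (f : α → β) : Prop :=
  ∃ (p : Prog) (T : α → ℕ), PolyBound T ∧ ∀ a, ∃ t ≤ T a, Runs p (enc a) (enc (f a)) t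

theorem PolyTime.polyBound_size {f : α → β} (hf : PolyTime f) :
    PolyBound fun a => (enc (f a)).size := by
  obtain ⟨p, T, hT, h⟩ := hf
  refine hT.mono fun a => ?_
  obtain ⟨t, ht, hr⟩ := h a
  exact hr.size_le.trans ht

theorem PolyTime.polyBound_comp {f : α → β} (hf : PolyTime f) {g : β → ℕ} (hg : PolyBound g) :
    PolyBound fun a => g (f a) := by
  obtain ⟨Q, hQ⟩ := hg
  exact (hf.polyBound_size.eval Q).mono fun a => hQ (f a)

/-- A function that acts on encodings as a program with a single primitive operation. -/
theorem PolyTime.of_op {f : α → β} (o : Op) (ho : ∀ a, o.run (enc a) = enc (f a))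
    (hc : PolyBound fun a : α => o.cost (enc a)) : PolyTime f :=
  ⟨.op o, _, hc, fun a => ⟨_, le_rfl, ho a ▸ Runs.op o (enc a)⟩⟩

@[fun_prop]
theorem PolyTime.id : PolyTime fun a : α => a :=
  .of_op .id (fun _ => rfl) <| (PolyBound.size.add PolyBound.size).mono fun a => by
    simp [Op.cost, Op.run]

@[fun_prop]
theorem PolyTime.comp {f : β → γ} {g : α → β} (hf : PolyTime f) (hg : PolyTime g) :
    PolyTime fun a => f (g a) := by
  have hg' := hg
  obtain ⟨p, T, hT, h⟩ := hf
  obtain ⟨q, S, hS, k⟩ := hg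
  refine ⟨.comp p q, fun a => S a + T (g a) + 1,
    (hS.add (hg'.polyBound_comp hT)).add (.const 1), fun a => ?_⟩
  obtain ⟨s, hs, hr⟩ := k a
  obtain ⟨t, ht, hr'⟩ := h (g a)
  exact ⟨_, by dsimp only; omega, hr.comp hr'⟩

@[fun_prop]
theorem PolyTime.prodMk {f : α → β} {g : α → γ} (hf : PolyTime f) (hg : PolyTime g) :
    PolyTime fun a => (f a, g a) := by
  obtain ⟨p, T, hT, h⟩ := hf
  obtain ⟨q, S, hS, k⟩ := hg
  refine ⟨.pair p q, fun a => T a + S a + (enc a).size + 1,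
    ((hT.add hS).add .size).add (.const 1), fun a => ?_⟩
  obtain ⟨s, hs, hr⟩ := k a
  obtain ⟨t, ht, hr'⟩ := h a
  exact ⟨_, by dsimp only; omega, hr'.pair hr⟩

theorem polyTime_fst : PolyTime fun a : α × β => a.1 :=
  .of_op .fst (fun _ => rfl) <| (PolyBound.size.add PolyBound.size).mono fun a => by
    simp [Op.cost, Op.run, enc, Val.size]; omega

theorem polyTime_snd : PolyTime fun a : α × β => a.2 :=
  .of_op .snd (fun _ => rfl) <| (PolyBound.size.add PolyBound.size).mono fun a => by
    simp [Op.cost, Op.run, enc, Val.size]; omega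

@[fun_prop]
theorem PolyTime.fst {f : α → β × γ} (hf : PolyTime f) : PolyTime fun a => (f a).1 :=
  polyTime_fst.comp hf

@[fun_prop]
theorem PolyTime.snd {f : α → β × γ} (hf : PolyTime f) : PolyTime fun a => (f a).2 :=
  polyTime_snd.comp hf

/-- The bound depends on the input because each `pair` used to build the constant charges the size
of the input. -/
theorem exists_runs_const (w : Val) : ∃ (p : Prog) (c : ℕ), ∀ v : Val, ∃ t ≤ c * v.size + c,
    Runs p v w t := by
  induction w with
  | int z =>
    refine ⟨.op (.const z), (Val.int z).size + 1, fun v => ⟨_, ?_, .op _ v⟩⟩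
    simp only [Op.cost, Op.run]
    nlinarith [Val.one_le_size v]
  | pair a b iha ihb =>
    obtain ⟨p, c, hp⟩ := iha
    obtain ⟨q, e, hq⟩ := ihb
    refine ⟨.pair p q, c + e + 1, fun v => ?_⟩
    obtain ⟨s, hs, hr⟩ := hp v
    obtain ⟨t, ht, hr'⟩ := hq v
    exact ⟨_, by nlinarith, hr.pair hr'⟩

@[fun_prop]
theorem PolyTime.const (b : β) : PolyTime fun _ : α => b := by
  obtain ⟨p, c, hp⟩ := exists_runs_const (enc b)
  exact ⟨p, fun a => c * (enc a).size + c, ((PolyBound.const c).mul .size).add (.const c),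
    fun a => hp _⟩

@[fun_prop]
theorem PolyTime.ite {c : α → Prop} [DecidablePred c] {f g : α → β}
    (hc : PolyTime fun a => decide (c a)) (hf : PolyTime f) (hg : PolyTime g) :
    PolyTime fun a => if c a then f a else g a := by
  obtain ⟨r, R, hR, l⟩ := hc
  obtain ⟨p, T, hT, h⟩ := hf
  obtain ⟨q, S, hS, k⟩ := hg
  refine ⟨.ite r p q, fun a => R a + (T a + S a) + (enc a).size + 1,
    ((hR.add (hT.add hS)).add .size).add (.const 1), fun a => ?_⟩
  obtain ⟨s, hs, hr⟩ := k a
  obtain ⟨t, ht, hr'⟩ := h a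
  obtain ⟨u, hu, hr''⟩ := l a
  dsimp only at hr'' ⊢
  by_cases hca : c a
  · rw [if_pos hca]
    refine ⟨_, ?_, hr''.ite_true ?_ hr'⟩
    · omega
    · simp [enc, hca]
  · rw [if_neg hca]
    refine ⟨_, ?_, Runs.ite_false (by simpa [enc, hca] using hr'') hr⟩
    omega

/-! ### Integers and truth values -/

theorem size_enc_int (z : ℤ) : (enc z).size = z.natAbs.size + 1 := rfl

theorem size_enc_prod (x : α × β) : (enc x).size = (enc x.1).size + (enc x.2).size + 1 := rfl

theorem natAbs_size_add_le (x y : ℤ) :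
    (x + y).natAbs.size ≤ x.natAbs.size + y.natAbs.size + 1 := by
  rw [Nat.size_le]
  have hx := Nat.lt_size_self x.natAbs
  have hy := Nat.lt_size_self y.natAbs
  have h1 : 2 ^ x.natAbs.size ≤ 2 ^ (x.natAbs.size + y.natAbs.size) :=
    Nat.pow_le_pow_right (by norm_num) (by omega)
  have h2 : 2 ^ y.natAbs.size ≤ 2 ^ (x.natAbs.size + y.natAbs.size) :=
    Nat.pow_le_pow_right (by norm_num) (by omega)
  have := Int.natAbs_add_le x y
  rw [pow_succ]
  omega

theorem natAbs_size_mul_le (x y : ℤ) :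
    (x * y).natAbs.size ≤ x.natAbs.size + y.natAbs.size := by
  rw [Nat.size_le, Int.natAbs_mul, pow_add]
  exact Nat.mul_lt_mul'' (Nat.lt_size_self _) (Nat.lt_size_self _)

theorem polyTime_int_add : PolyTime fun x : ℤ × ℤ => x.1 + x.2 :=
  .of_op .add (fun _ => rfl) <| ((PolyBound.size.add PolyBound.size).add (.const 1)).mono
    fun ⟨x, y⟩ => by
      have := natAbs_size_add_le x y
      simp [Op.cost, Op.run, enc, Val.size] at *; omega

theorem polyTime_int_sub : PolyTime fun x : ℤ × ℤ => x.1 - x.2 :=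
  .of_op .sub (fun _ => rfl) <| ((PolyBound.size.add PolyBound.size).add (.const 1)).mono
    fun ⟨x, y⟩ => by
      have := natAbs_size_add_le x (-y)
      rw [← sub_eq_add_neg] at this
      simp [Op.cost, Op.run, enc, Val.size] at *; omega

theorem polyTime_int_mul : PolyTime fun x : ℤ × ℤ => x.1 * x.2 :=
  .of_op .mul (fun _ => rfl) <|
    ((PolyBound.size.mul PolyBound.size).add (PolyBound.size.add PolyBound.size)).mono
    fun ⟨x, y⟩ => by
      have := natAbs_size_mul_le x y
      simp only [Op.cost, Op.run, enc, Val.size] at *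
      have : (x.natAbs.size + 1) * (y.natAbs.size + 1) ≤
        (x.natAbs.size + 1 + (y.natAbs.size + 1) + 1) *
          (x.natAbs.size + 1 + (y.natAbs.size + 1) + 1) := Nat.mul_le_mul (by omega) (by omega)
      omega

theorem polyTime_int_le : PolyTime fun x : ℤ × ℤ => decide (x.1 ≤ x.2) :=
  .of_op .le (fun x => by simp [Op.run, enc]) <| (PolyBound.size.add (.const 2)).mono
    fun ⟨x, y⟩ => by
      simp only [Op.cost, Op.run, enc, Val.size]
      split <;> simp

variable {f g : α → ℤ}

@[fun_prop]
theorem PolyTime.int_add (hf : PolyTime f) (hg : PolyTime g) : PolyTime fun a => f a + g a :=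
  polyTime_int_add.comp (hf.prodMk hg)

@[fun_prop]
theorem PolyTime.int_sub (hf : PolyTime f) (hg : PolyTime g) : PolyTime fun a => f a - g a :=
  polyTime_int_sub.comp (hf.prodMk hg)

@[fun_prop]
theorem PolyTime.int_mul (hf : PolyTime f) (hg : PolyTime g) : PolyTime fun a => f a * g a :=
  polyTime_int_mul.comp (hf.prodMk hg)

@[fun_prop]
theorem PolyTime.int_neg (hf : PolyTime f) : PolyTime fun a => -f a := by
  simpa using (PolyTime.const (0 : ℤ)).int_sub hf

@[fun_prop]
theorem PolyTime.int_le (hf : PolyTime f) (hg : PolyTime g) :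
    PolyTime fun a => decide (f a ≤ g a) :=
  polyTime_int_le.comp (hf.prodMk hg)

@[fun_prop]
theorem PolyTime.int_max (hf : PolyTime f) (hg : PolyTime g) : PolyTime fun a => max (f a) (g a) :=
  (hf.int_le hg).ite hg hf

@[fun_prop]
theorem PolyTime.decide_not {p : α → Prop} [DecidablePred p] (hp : PolyTime fun a => decide (p a)) :
    PolyTime fun a => decide (¬p a) := by
  convert hp.ite (PolyTime.const false) (PolyTime.const true) using 2 with a
  by_cases h : p a <;> simp [h]

@[fun_prop]
theorem PolyTime.decide_and {p q : α → Prop} [DecidablePred p] [DecidablePred q]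
    (hp : PolyTime fun a => decide (p a)) (hq : PolyTime fun a => decide (q a)) :
    PolyTime fun a => decide (p a ∧ q a) := by
  convert hp.ite hq (PolyTime.const false) using 2 with a
  by_cases h : p a <;> simp [h]

@[fun_prop]
theorem PolyTime.int_lt (hf : PolyTime f) (hg : PolyTime g) :
    PolyTime fun a => decide (f a < g a) := by
  simpa only [not_le] using (hg.int_le hf).decide_not

@[fun_prop]
theorem PolyTime.int_eq (hf : PolyTime f) (hg : PolyTime g) :
    PolyTime fun a => decide (f a = g a) := by
  simpa only [le_antisymm_iff] using (hf.int_le hg).decide_and (hg.int_le hf)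

/-- The index set does not depend on the input, so the sum unrolls into a fixed program without a
loop. -/
theorem PolyTime.finset_sum {ι : Type*} (s : Finset ι) {f : α → ι → ℤ}
    (hf : ∀ i ∈ s, PolyTime fun a => f a i) : PolyTime fun a => ∑ i ∈ s, f a i := by
  classical
  induction s using Finset.induction_on with
  | empty => simpa using PolyTime.const 0
  | insert i s hi ih =>
    simp only [Finset.sum_insert hi]
    exact (hf i (by simp)).int_add (ih fun j hj => hf j (by simp [hj]))

theorem PolyTime.finset_prod {ι : Type*} (s : Finset ι) {f : α → ι → ℤ}
    (hf : ∀ i ∈ s, PolyTime fun a => f a i) : PolyTime fun a => ∏ i ∈ s, f a i := by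
  classical
  induction s using Finset.induction_on with
  | empty => simpa using PolyTime.const 1
  | insert i s hi ih =>
    simp only [Finset.prod_insert hi]
    exact (hf i (by simp)).int_mul (ih fun j hj => hf j (by simp [hj]))

theorem PolyTime.decide_forall {ι : Type*} [Fintype ι] {p : α → ι → Prop}
    [∀ a i, Decidable (p a i)] [∀ a, Decidable (∀ i, p a i)]
    (hp : ∀ i, PolyTime fun a => decide (p a i)) :
    PolyTime fun a => decide (∀ i, p a i) := by
  classical
  suffices ∀ s : Finset ι, PolyTime fun a => decide (∀ i ∈ s, p a i) by
    simpa using this Finset.univ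
  intro s
  induction s using Finset.induction_on with
  | empty => simpa using PolyTime.const true
  | insert i s hi ih =>
    simp only [Finset.forall_mem_insert]
    exact (hp i).decide_and ih

@[fun_prop]
theorem PolyTime.rat_num {f : α → ℚ} (hf : PolyTime f) : PolyTime fun a => (f a).num :=
  PolyTime.comp (f := Rat.num) (.of_op .fst (fun _ => rfl) <|
    (PolyBound.size.add PolyBound.size).mono fun a => by
      simp [Op.cost, Op.run, enc, Val.size, Val.ofRat]; omega) hf

@[fun_prop]
theorem PolyTime.rat_den {f : α → ℚ} (hf : PolyTime f) : PolyTime fun a => ((f a).den : ℤ) :=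
  PolyTime.comp (f := fun q : ℚ => (q.den : ℤ)) (.of_op .snd (fun _ => rfl) <|
    (PolyBound.size.add PolyBound.size).mono fun a => by
      simp [Op.cost, Op.run, enc, Val.size, Val.ofRat]; omega) hf

/-! ### Tuples of fixed length -/

/-- Tuples are nested pairs, so coordinates are read by a fixed number of projections and tuples are
built by repeated pairing. -/
theorem enc_tuple_succ {k : ℕ} (f : Fin (k + 1) → α) :
    enc f = .pair (enc (f 0)) (enc fun j : Fin k => f j.succ) := by
  simp [enc, Val.ofTuple, List.ofFn_succ, Val.ofList]

@[fun_prop]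
theorem polyTime_apply {k : ℕ} (j : Fin k) : PolyTime fun f : Fin k → α => f j := by
  induction k with
  | zero => exact j.elim0
  | succ k ih =>
    cases j using Fin.cases with
    | zero =>
      refine .of_op .fst (fun f => by rw [enc_tuple_succ]; rfl) <|
        (PolyBound.size.add PolyBound.size).mono fun a => ?_
      simp only [enc_tuple_succ]
      simp [Op.cost, Op.run, Val.size]; omega
    | succ j =>
      refine PolyTime.comp (f := fun f : Fin k → α => f j) (ih j)
        (g := fun f : Fin (k + 1) → α => fun j => f j.succ) ?_
      refine .of_op .snd (fun f => by rw [enc_tuple_succ]; rfl) <|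
        (PolyBound.size.add PolyBound.size).mono fun a => ?_
      simp only [enc_tuple_succ]
      simp [Op.cost, Op.run, Val.size]; omega

theorem PolyTime.apply {k : ℕ} {f : β → Fin k → α} (hf : PolyTime f) (j : Fin k) :
    PolyTime fun x => f x j :=
  (polyTime_apply j).comp hf

theorem PolyTime.tuple {k : ℕ} {f : β → Fin k → α} (hf : ∀ j, PolyTime fun x => f x j) :
    PolyTime f := by
  induction k with
  | zero =>
    convert PolyTime.const (α := β) (Fin.elim0 : Fin 0 → α) using 2
  | succ k ih =>
    obtain ⟨p, T, hT, h⟩ := (hf 0).prodMk (ih (f := fun x j => f x j.succ) fun j => hf j.succ)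
    refine ⟨p, T, hT, fun a => ?_⟩
    rw [enc_tuple_succ]
    exact h a

end

/-! ### Lists -/

section

variable {α β : Type}

/-- Left folds are the only loops analysed for running time; this and the next identities reduce
other list operations to them. -/
theorem foldl_cons_eq (l l' : List α) : l.foldl (fun s a => a :: s) l' = l.reverse ++ l' := by
  induction l generalizing l' with
  | nil => rfl
  | cons a l ih => simp [ih]

theorem foldl_map_cons_eq (f : α → β) (l : List α) (l' : List β) :
    l.foldl (fun s a => f a :: s) l' = (l.map f).reverse ++ l' := by
  induction l generalizing l' with
  | nil => rfl
  | cons a l ih => simp [ih]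

theorem foldl_append_eq (L : List (List α)) (l : List α) :
    L.foldl (fun s a => s ++ a) l = l ++ L.flatten := by
  induction L generalizing l with
  | nil => simp
  | cons a L ih => simp [ih]

theorem filter_eq_flatMap (p : α → Bool) (l : List α) :
    l.filter p = l.flatMap fun a => if p a then [a] else [] := by
  induction l with
  | nil => rfl
  | cons a l ih => by_cases h : p a <;> simp [h, ih]

theorem foldl_max_mem (l : List ℤ) (z : ℤ) : l.foldl max z ∈ z :: l := by
  induction l generalizing z with
  | nil => simp
  | cons a l ih =>
    rw [List.foldl_cons]
    rcases List.mem_cons.1 (ih (max z a)) with h | h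
    · rw [h]
      rcases max_choice z a with h | h <;> simp [h]
    · simp [h]

theorem le_foldl_max (l : List ℤ) (z : ℤ) : ∀ a ∈ z :: l, a ≤ l.foldl max z := by
  induction l generalizing z with
  | nil => simp
  | cons b l ih =>
    intro a ha
    rw [List.foldl_cons]
    have h := ih (max z b) (max z b) (by simp)
    simp only [List.mem_cons] at ha
    rcases ha with rfl | rfl | ha
    · exact (le_max_left _ _).trans h
    · exact (le_max_right _ _).trans h
    · exact ih _ _ (by simp [ha])

/-- The maximum of a list of integers, `0` for the empty list. -/
def listMax (l : List ℤ) : ℤ := l.foldl max (l.headD 0)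

theorem listMax_mem {l : List ℤ} (hl : l ≠ []) : listMax l ∈ l := by
  cases l with
  | nil => simp at hl
  | cons a l =>
    have := foldl_max_mem (a :: l) a
    simpa [listMax] using this

theorem le_listMax {l : List ℤ} {a : ℤ} (ha : a ∈ l) : a ≤ listMax l :=
  le_foldl_max _ _ _ (by simp [ha])

/-- `pwFilter` is a right fold, hence the reversal. -/
theorem pwFilter_eq_foldl (R : α → α → Prop) [DecidableRel R] (l : List α) :
    l.pwFilter R = l.reverse.foldl (fun s a => if ∀ b ∈ s, R a b then a :: s else s) [] := by
  rw [List.foldl_reverse]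
  induction l with
  | nil => rfl
  | cons a l ih =>
    rw [List.foldr_cons, ← ih]
    split_ifs with h
    · exact List.pwFilter_cons_of_pos h
    · exact List.pwFilter_cons_of_neg h

/-- The list of all `k`-tuples of elements of a list. -/
def tuples : (k : ℕ) → List α → List (Fin k → α)
  | 0, _ => [Fin.elim0]
  | k + 1, l => l.flatMap fun a => (tuples k l).map fun t => Fin.cons a t

theorem mem_tuples {k : ℕ} {l : List α} {t : Fin k → α} : t ∈ tuples k l ↔ ∀ j, t j ∈ l := by
  induction k with
  | zero => simpa [tuples] using Subsingleton.elim _ _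
  | succ k ih =>
    simp only [tuples, List.mem_flatMap, List.mem_map, ih, Fin.forall_fin_succ]
    constructor
    · rintro ⟨a, ha, s, hs, rfl⟩
      simpa [ha] using hs
    · rintro ⟨h0, h⟩
      exact ⟨_, h0, _, h, Fin.cons_self_tail t⟩

end

section

variable {α β γ δ σ : Type} [Enc α] [Enc β] [Enc γ] [Enc δ] [Enc σ]

theorem size_enc_nil : (enc ([] : List α)).size = 1 := rfl

theorem size_enc_cons (a : α) (l : List α) :
    (enc (a :: l)).size = (enc a).size + (enc l).size + 1 := rfl

theorem size_enc_append (l l' : List α) :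
    (enc (l ++ l')).size + 1 = (enc l).size + (enc l').size := by
  induction l with
  | nil => rw [List.nil_append, size_enc_nil]; omega
  | cons a l ih => rw [List.cons_append, size_enc_cons, size_enc_cons]; omega

theorem size_enc_le_of_sublist {l l' : List α} (h : l.Sublist l') :
    (enc l).size ≤ (enc l').size := by
  induction h with
  | slnil => rfl
  | cons a h ih => rw [size_enc_cons]; omega
  | cons_cons a h ih => rw [size_enc_cons, size_enc_cons]; omega

theorem size_enc_le_of_mem {a : α} {l : List α} (h : a ∈ l) : (enc a).size ≤ (enc l).size := by
  have := size_enc_le_of_sublist (List.singleton_sublist.2 h)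
  rw [size_enc_cons] at this
  omega

theorem length_lt_size_enc (l : List α) : l.length < (enc l).size := by
  induction l with
  | nil => simp [size_enc_nil]
  | cons a l ih => rw [size_enc_cons, List.length_cons]; omega

theorem size_enc_reverse (l : List α) : (enc l.reverse).size = (enc l).size := by
  induction l with
  | nil => rfl
  | cons a l ih =>
    have := size_enc_append l.reverse [a]
    rw [List.reverse_cons]
    rw [size_enc_cons, size_enc_nil] at *
    omega

/-- The empty list is encoded by an integer and every other list by a pair. -/
theorem polyTime_isCons : PolyTime fun l : List α => !l.isEmpty :=
  .of_op .isPair (fun l => by cases l <;> rfl) <| (PolyBound.size.add (.const 2)).mono fun l => by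
    cases l <;> simp [Op.cost, Op.run, enc, Val.size, Val.ofList]

@[fun_prop]
theorem PolyTime.cons {f : δ → α} {l : δ → List α} (hf : PolyTime f) (hl : PolyTime l) :
    PolyTime fun x => f x :: l x :=
  hf.prodMk hl

@[fun_prop]
theorem PolyTime.tail {l : δ → List α} (hl : PolyTime l) : PolyTime fun x => (l x).tail :=
  -- On the code `0` of `[]`, the ill-formed argument of `snd`, the default result `0` is again the
  -- code of `[]`.
  PolyTime.comp (f := List.tail) (.of_op .snd (fun l => by cases l <;> rfl) <|
    (PolyBound.size.add PolyBound.size).mono fun l => by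
      cases l <;> simp [Op.cost, Op.run, enc, Val.size, Val.ofList]; omega) hl

@[fun_prop]
theorem PolyTime.headD {l : δ → List α} (hl : PolyTime l) (a : α) :
    PolyTime fun x => (l x).headD a := by
  refine PolyTime.comp (f := fun l : List α => l.headD a) ?_ hl
  obtain ⟨p, T, hT, h⟩ := polyTime_isCons (α := α)
  obtain ⟨q, S, hS, k⟩ := PolyTime.const (α := List α) a
  refine ⟨.ite p (.op .fst) q, fun l => T l + (((enc l).size + (enc l).size) + S l)
    + (enc l).size + 1, ((hT.add ((PolyBound.size.add .size).add hS)).add .size).add (.const 1),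
    fun l => ?_⟩
  obtain ⟨t, ht, hr⟩ := h l
  obtain ⟨s, hs, hr'⟩ := k l
  cases l with
  | nil => exact ⟨_, by dsimp only; omega, Runs.ite_false hr hr'⟩
  | cons b l =>
    refine ⟨_, ?_, Runs.ite_true hr ?_ (.op _ _)⟩
    · have : Op.fst.cost (enc (b :: l)) = (enc (b :: l)).size + (enc b).size := rfl
      rw [size_enc_cons] at *
      dsimp only
      rw [size_enc_cons]
      omega
    · simp [enc]

/-- A fold is computed in polynomial time if each step is, and all intermediate results have
polynomial size. -/
theorem PolyTime.foldl {init : δ → σ} {l : δ → List α} {step : δ × σ × α → σ}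
    (hi : PolyTime init) (hl : PolyTime l) (hs : PolyTime step) {B : δ → ℕ} (hB : PolyBound B)
    (hsz : ∀ x l', l' <+: l x →
      (enc (l'.foldl (fun s a => step (x, s, a)) (init x))).size ≤ B x) :
    PolyTime fun x => (l x).foldl (fun s a => step (x, s, a)) (init x) := by
  -- The loop body is typed on `α × List α`, where head and tail are projections; `(a, l)` and `a ::
  -- l` have the same encoding.
  have hbody : PolyTime fun y : δ × σ × (α × List α) =>
      (y.1, step (y.1, y.2.1, y.2.2.1), y.2.2.2) := by fun_prop
  have hcond : PolyTime fun y : δ × σ × List α => !y.2.2.isEmpty :=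
    polyTime_isCons.comp polyTime_snd.snd
  have hinit : PolyTime fun x => (x, init x, l x) := by fun_prop
  have hfin : PolyTime fun y : δ × σ × List α => y.2.1 := by fun_prop
  obtain ⟨pb, Tb, ⟨Pb, hPb⟩, hb⟩ := hbody
  obtain ⟨pc, Tc, ⟨Pc, hPc⟩, hc⟩ := hcond
  obtain ⟨pf, Tf, ⟨Pf, hPf⟩, hf⟩ := hfin
  -- If `M` bounds the size of every loop state, each round costs at most a fixed polynomial in `M`,
  -- and there are `l.length + 1` tests of the condition.
  have key : ∀ (x : δ) (M : ℕ) (l : List α) (s : σ),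
      (∀ l₁ l₂, l = l₁ ++ l₂ →
        (enc (x, l₁.foldl (fun s a => step (x, s, a)) s, l₂)).size ≤ M) →
      ∃ t ≤ (l.length + 1) * (Pc.eval M + Pb.eval M + M + 1),
        Runs (.loop pc pb) (enc (x, s, l))
          (enc (x, l.foldl (fun s a => step (x, s, a)) s, ([] : List α))) t := by
    intro x M l
    induction l with
    | nil =>
      intro s h
      obtain ⟨t, ht, hr⟩ := hc (x, s, [])
      have hM := h [] [] rfl
      have := (ht.trans (hPc _)).trans (eval_mono Pc hM)
      refine ⟨_, ?_, Runs.loop_stop hr⟩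
      simp only [List.foldl_nil] at hM
      simp only [List.length_nil]
      omega
    | cons a l ih =>
      intro s h
      obtain ⟨t, ht, hr⟩ := hc (x, s, a :: l)
      obtain ⟨u, hu, hr'⟩ := hb (x, s, (a, l))
      obtain ⟨w, hw, hr''⟩ := ih (step (x, s, a)) fun l₁ l₂ hl => h (a :: l₁) l₂ (by simp [hl])
      have hM := h [] (a :: l) rfl
      have h1 := (ht.trans (hPc _)).trans (eval_mono Pc hM)
      have h2 := (hu.trans (hPb _)).trans (eval_mono Pb hM)
      refine ⟨_, ?_, Runs.loop_step hr (by simp [enc]) hr' hr''⟩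
      simp only [List.foldl_nil] at hM
      simp only [List.length_cons]
      rw [add_mul _ 1, one_mul]
      omega
  obtain ⟨pi, Ti, hTi, hi⟩ := hinit
  -- The summand `2` pays for the two pair nodes of a loop state.
  set M : δ → ℕ := fun x => (enc x).size + B x + (enc (l x)).size + 2 with hMdef
  have hM : PolyBound M := ((PolyBound.size.add hB).add hl.polyBound_size).add (.const 2)
  refine ⟨.comp pf (.comp (.loop pc pb) pi), fun x => (Ti x +
    (enc (l x)).size * (Pc.eval (M x) + Pb.eval (M x) + M x + 1) + 1) + Pf.eval (M x) + 1,
    (((hTi.add (hl.polyBound_size.mul ((((hM.eval Pc).add (hM.eval Pb)).add hM).add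
      (.const 1)))).add (.const 1)).add (hM.eval Pf)).add (.const 1), fun x => ?_⟩
  obtain ⟨t, ht, hr⟩ := hi x
  have hall : ∀ l₁ l₂, l x = l₁ ++ l₂ →
      (enc (x, l₁.foldl (fun s a => step (x, s, a)) (init x), l₂)).size ≤ M x := by
    intro l₁ l₂ h
    have h1 := hsz x l₁ ⟨l₂, h.symm⟩
    have h2 := size_enc_le_of_sublist (h ▸ List.sublist_append_right l₁ l₂)
    simp only [size_enc_prod, hMdef]
    omega
  obtain ⟨u, hu, hr'⟩ := key x (M x) (l x) (init x) hall
  obtain ⟨w, hw, hr''⟩ := hf (x, (l x).foldl (fun s a => step (x, s, a)) (init x), [])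
  have h1 := (hw.trans (hPf _)).trans (eval_mono Pf (hall (l x) [] (by simp)))
  have h2 := Nat.mul_le_mul_right (Pc.eval (M x) + Pb.eval (M x) + M x + 1)
    (length_lt_size_enc (l x))
  refine ⟨_, ?_, (hr.comp hr').comp hr''⟩
  dsimp only
  simp only [Nat.succ_eq_add_one] at h2
  omega

theorem PolyTime.reverseAux {l l' : δ → List α} (hl : PolyTime l) (hl' : PolyTime l') :
    PolyTime fun x => (l x).reverse ++ l' x := by
  simp only [← foldl_cons_eq]
  refine PolyTime.foldl (step := fun y : δ × List α × α => y.2.2 :: y.2.1) hl' hl (by fun_prop)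
    (hl.polyBound_size.add hl'.polyBound_size) fun x k hk => ?_
  have h1 := size_enc_append k.reverse (l' x)
  have h2 := size_enc_le_of_sublist hk.sublist
  rw [size_enc_reverse] at h1
  simp only [foldl_cons_eq]
  omega

@[fun_prop]
theorem PolyTime.reverse {l : δ → List α} (hl : PolyTime l) : PolyTime fun x => (l x).reverse := by
  simpa using hl.reverseAux (PolyTime.const [])

@[fun_prop]
theorem PolyTime.append {l l' : δ → List α} (hl : PolyTime l) (hl' : PolyTime l') :
    PolyTime fun x => l x ++ l' x := by
  simpa using hl.reverse.reverseAux hl'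

theorem size_enc_map_le {α : Type} (f : α → β) (l : List α) (c : ℕ) (h : ∀ a ∈ l, (enc (f a)).size ≤ c) :
    (enc (l.map f)).size ≤ l.length * (c + 1) + 1 := by
  induction l with
  | nil => simp [size_enc_nil]
  | cons a l ih =>
    have h1 := h a (by simp)
    have h2 := ih fun b hb => h b (by simp [hb])
    rw [List.map_cons, size_enc_cons, List.length_cons, add_mul, one_mul]
    omega

theorem PolyTime.list_map {f : δ → α → β} {l : δ → List α}
    (hf : PolyTime fun y : δ × α => f y.1 y.2) (hl : PolyTime l) :
    PolyTime fun x => (l x).map (f x) := by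
  -- Consing the images in a left fold produces them in reverse order.
  suffices PolyTime fun x => ((l x).map (f x)).reverse by simpa using this.reverse
  obtain ⟨P, hP⟩ := hf.polyBound_size
  have h : PolyTime fun x => (l x).foldl (fun s a => f x a :: s) [] := by
    have hM : PolyBound fun x => (enc x).size + (enc (l x)).size + 1 :=
      (PolyBound.size.add hl.polyBound_size).add (.const 1)
    refine PolyTime.foldl (step := fun y : δ × List β × α => f y.1 y.2.2 :: y.2.1)
      (PolyTime.const []) hl ?_
      ((hl.polyBound_size.mul ((hM.eval P).add (.const 1))).add (.const 1)) fun x k hk => ?_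
    · have : PolyTime fun y : δ × List β × α => f y.1 y.2.2 :=
        hf.comp (polyTime_fst.prodMk polyTime_snd.snd)
      fun_prop
    · have h2 := size_enc_le_of_sublist hk.sublist
      have h3 := length_lt_size_enc k
      simp only [foldl_map_cons_eq, List.append_nil, size_enc_reverse]
      refine (size_enc_map_le _ _ (P.eval ((enc x).size + (enc (l x)).size + 1))
        fun a ha => (hP (x, a)).trans (eval_mono P ?_)).trans ?_
      · have := size_enc_le_of_mem (hk.subset ha)
        simp only [size_enc_prod]
        omega
      · exact Nat.add_le_add_right (Nat.mul_le_mul_right _ (by omega)) 1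
  simpa only [foldl_map_cons_eq, List.append_nil] using h

theorem size_enc_flatten_le (L : List (List α)) : (enc L.flatten).size ≤ (enc L).size := by
  induction L with
  | nil => simp [size_enc_nil]
  | cons a L ih =>
    have := size_enc_append a L.flatten
    rw [List.flatten_cons, size_enc_cons]
    omega

@[fun_prop]
theorem PolyTime.flatten {L : δ → List (List α)} (hL : PolyTime L) :
    PolyTime fun x => (L x).flatten := by
  have h : PolyTime fun x => (L x).foldl (fun s a => s ++ a) [] := by
    refine PolyTime.foldl (step := fun y : δ × List α × List α => y.2.1 ++ y.2.2)
      (PolyTime.const []) hL (by fun_prop) hL.polyBound_size fun x k hk => ?_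
    simp only [foldl_append_eq, List.nil_append]
    exact (size_enc_flatten_le k).trans (size_enc_le_of_sublist hk.sublist)
  simpa only [foldl_append_eq, List.nil_append] using h

theorem PolyTime.flatMap {f : δ → α → List β} {l : δ → List α}
    (hf : PolyTime fun y : δ × α => f y.1 y.2) (hl : PolyTime l) :
    PolyTime fun x => (l x).flatMap (f x) := by
  simp only [List.flatMap_def]
  exact (PolyTime.list_map hf hl).flatten

theorem PolyTime.filter {p : δ → α → Bool} {l : δ → List α}
    (hp : PolyTime fun y : δ × α => p y.1 y.2) (hl : PolyTime l) :
    PolyTime fun x => (l x).filter (p x) := by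
  simp only [filter_eq_flatMap]
  refine PolyTime.flatMap (f := fun x a => if p x a then [a] else [])
    (PolyTime.ite ?_ (by fun_prop) (by fun_prop)) hl
  simpa using hp

theorem PolyTime.decide_forall_mem {p : δ → α → Prop} [∀ x a, Decidable (p x a)] {l : δ → List α}
    (hp : PolyTime fun y : δ × α => decide (p y.1 y.2)) (hl : PolyTime l) :
    PolyTime fun x => decide (∀ a ∈ l x, p x a) := by
  have h : PolyTime fun x => !((l x).filter fun a => decide ¬p x a).isEmpty :=
    (polyTime_isCons (α := α)).comp
      (PolyTime.filter (p := fun x a => decide ¬p x a) hp.decide_not hl)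
  convert (PolyTime.ite (c := fun x => (!((l x).filter fun a => decide ¬p x a).isEmpty) = true)
    (by simpa only [Bool.decide_eq_true] using h)
    (PolyTime.const false) (PolyTime.const true)) using 2 with x
  rw [Bool.eq_iff_iff]
  simp

theorem PolyTime.list_prod {l : δ → List ℤ} (hl : PolyTime l) : PolyTime fun x => (l x).prod := by
  have h : PolyTime fun x => (l x).foldl (fun s a => s * a) 1 := by
    refine PolyTime.foldl (step := fun y : δ × ℤ × ℤ => y.2.1 * y.2.2)
      (PolyTime.const 1) hl (by fun_prop) (hl.polyBound_size.add (.const 1)) fun x k hk => ?_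
    have h1 := size_enc_le_of_sublist hk.sublist
    -- Bit lengths add under multiplication, so a partial product is no larger than the list of its
    -- factors.
    suffices h : ∀ (k : List ℤ) (z : ℤ),
        (enc (k.foldl (fun s a => s * a) z)).size + 1 ≤ (enc k).size + (enc z).size by
      have := h k 1
      have h1' : (enc (1 : ℤ)).size = 2 := by simp [size_enc_int]
      dsimp only
      omega
    intro k
    induction k with
    | nil => intro z; simp only [List.foldl_nil, size_enc_nil]; omega
    | cons a k ih =>
      intro z
      have h2 := ih (z * a)
      have h3 := natAbs_size_mul_le z a
      simp only [List.foldl_cons, size_enc_cons, size_enc_int] at *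
      omega
  simpa only [List.prod_eq_foldl] using h

theorem PolyTime.listMax {l : δ → List ℤ} (hl : PolyTime l) :
    PolyTime fun x => listMax (l x) := by
  refine PolyTime.foldl (step := fun y : δ × ℤ × ℤ => max y.2.1 y.2.2)
    (hl.headD 0) hl (by fun_prop)
    (hl.polyBound_size.add (hl.headD 0).polyBound_size) fun x k hk => ?_
  dsimp only
  change (enc (k.foldl max ((l x).headD 0))).size ≤ _
  rcases List.mem_cons.1 (foldl_max_mem k ((l x).headD 0)) with h | h
  · rw [h]
    omega
  · have := size_enc_le_of_mem (hk.subset h)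
    omega

theorem PolyTime.pwFilter {R : α → α → Prop} [DecidableRel R] {l : δ → List α}
    (hR : PolyTime fun y : α × α => decide (R y.1 y.2)) (hl : PolyTime l) :
    PolyTime fun x => (l x).pwFilter R := by
  simp only [pwFilter_eq_foldl]
  refine PolyTime.foldl
    (step := fun y : δ × List α × α => if ∀ b ∈ y.2.1, R y.2.2 b then y.2.2 :: y.2.1 else y.2.1)
    (PolyTime.const []) hl.reverse ?_ hl.polyBound_size fun x k hk => ?_
  · refine PolyTime.ite (PolyTime.decide_forall_mem (p := fun (y : δ × List α × α) b => R y.2.2 b)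
      ?_ (by fun_prop)) (by fun_prop) (by fun_prop)
    exact hR.comp (g := fun y : (δ × List α × α) × α => (y.1.2.2, y.2)) (by fun_prop)
  -- Each accumulator is the `pwFilter` of a reversed prefix of the reversed list, hence a sublist
  -- of the original list.
  · have h := pwFilter_eq_foldl R k.reverse
    rw [List.reverse_reverse] at h
    dsimp only
    rw [← h, ← size_enc_reverse (l x)]
    refine (size_enc_le_of_sublist (List.pwFilter_sublist _)).trans ?_
    rw [size_enc_reverse]
    exact size_enc_le_of_sublist hk.sublist

/-- The recursion on the fixed `k` unrolls into `k` nested list operations; the degree of the time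
bound may grow with `k`. -/
theorem polyTime_tuples (k : ℕ) : PolyTime fun l : List α => tuples k l := by
  induction k with
  | zero => exact PolyTime.const _
  | succ k ih =>
    refine PolyTime.flatMap (f := fun l a => (tuples k l).map fun t => Fin.cons a t) ?_ .id
    refine PolyTime.list_map (f := fun (y : List α × α) (t : Fin k → α) => Fin.cons y.2 t) ?_
      (ih.comp polyTime_fst)
    refine PolyTime.tuple fun j => ?_
    cases j using Fin.cases with
    | zero => simpa using polyTime_fst.snd
    | succ j => simpa using (polyTime_apply j).comp polyTime_snd

theorem PolyTime.tuples (k : ℕ) {l : δ → List α} (hl : PolyTime l) :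
    PolyTime fun x => tuples k (l x) :=
  (polyTime_tuples k).comp hl

end

/-! ## The algorithm -/

/-- The generalized cross product of `k` vectors of length `k + 1`. -/
def cross {R : Type*} [CommRing R] {k : ℕ} (t : Fin k → Fin (k + 1) → R) : Fin (k + 1) → R :=
  fun j => (Matrix.of (Fin.cons (Pi.single j 1) t : Fin (k + 1) → Fin (k + 1) → R)).det

/-- The integer vector obtained by multiplying a rational vector with all its denominators. -/
def clearDen {k : ℕ} (q : Fin k → ℚ) : Fin k → ℤ :=
  fun j => (q j).num * ∏ i ∈ Finset.univ.erase j, ((q i).den : ℤ)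

/-- An integer vector `r` such that `a ⬝ᵥ x ≤ b` if and only if `r 0 + ∑ j, r (j + 1) * x j ≤ 0`. -/
def homRow {d : ℕ} (q : (Fin d → ℚ) × ℚ) : Fin (d + 1) → ℤ :=
  Fin.cons (-clearDen (Fin.cons q.2 q.1 : Fin (d + 1) → ℚ) 0)
    fun j => clearDen (Fin.cons q.2 q.1 : Fin (d + 1) → ℚ) j.succ

/-- Homogeneous coordinates, with positive first coordinate, of points of the polyhedron
`{x | ∀ r ∈ rows, r 0 + ∑ j, r (j + 1) * x j ≤ 0}`, among them all vertices. -/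
def vertexList {d : ℕ} (rows : List (Fin (d + 1) → ℤ)) : List (Fin (d + 1) → ℤ) :=
  ((tuples d rows).map fun t j => cross t 0 * cross t j).filter
    fun y => decide (0 < y 0 ∧ ∀ r ∈ rows, r ⬝ᵥ y ≤ 0)

/-- The distinct first coordinates of the vectors in a list of lists. -/
def denominators {d : ℕ} (W : List (List (Fin (d + 1) → ℤ))) : List ℤ :=
  (W.flatten.map fun y => y 0).pwFilter (· ≠ ·)

/-- The point with homogeneous coordinates `y`, multiplied by the product of `D ∋ y 0`. -/
def rescale {d : ℕ} (D : List ℤ) (y : Fin (d + 1) → ℤ) : Fin d → ℤ :=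
  fun j => y j.succ * (D.filter fun z => decide (z ≠ y 0)).prod

/-- The vertex lists of the polyhedra of a list of systems, multiplied by a common denominator. -/
def pointLists {d : ℕ} (W : List (List (Fin (d + 1) → ℤ))) : List (List (Fin d → ℤ)) :=
  W.map fun V => V.map (rescale (denominators W))

/-- All pairs of points of a common list, together with that list. -/
def pointPairs {α : Type} (U : List (List α)) : List (List α × α × α) :=
  U.flatMap fun V => V.flatMap fun u => V.map fun u' => (V, u, u')

/-- Integer vectors `c`, orthogonal to `e` linearly independent differences of points of lists in
`U` that maximize `c` over their list. -/
def normals {e : ℕ} (U : List (List (Fin (e + 1) → ℤ))) : List (Fin (e + 1) → ℤ) :=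
  (((tuples e (pointPairs U)).flatMap fun t =>
    [(t, cross fun j => (t j).2.1 - (t j).2.2), (t, -cross fun j => (t j).2.1 - (t j).2.2)]).filter
      fun y => decide ((¬∀ j, y.2 j = 0) ∧ ∀ j, ∀ w ∈ (y.1 j).1,
        y.2 ⬝ᵥ w ≤ y.2 ⬝ᵥ (y.1 j).2.1)).map fun y => y.2

/-- Equality holds in the Cauchy–Schwarz inequality for two vectors with positive product. -/
def SameDir {k : ℕ} (c c' : Fin k → ℤ) : Prop :=
  (c ⬝ᵥ c') * (c ⬝ᵥ c') = (c ⬝ᵥ c) * (c' ⬝ᵥ c') ∧ 0 < c ⬝ᵥ c'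

instance {k : ℕ} (c c' : Fin k → ℤ) : Decidable (SameDir c c') := by
  unfold SameDir
  infer_instance

/-- The maximum of `c` over a list of points. -/
def support {k : ℕ} (c : Fin k → ℤ) (V : List (Fin k → ℤ)) : ℤ :=
  listMax (V.map fun u => c ⬝ᵥ u)

/-- The inequality with normal vector `c` that is tight for all lists in `U`, whose points are
multiplied by `Q`. -/
def supportIneq {k : ℕ} (Q : ℤ) (U : List (List (Fin k → ℤ))) (c : Fin k → ℤ) :
    (Fin k → ℤ) × List ℤ × ℤ :=
  (fun j => Q * c j, U.tail.map fun V => support c (U.headD []) - support c V,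
    support c (U.headD []))

/-- The list `[n, …, 1]`. -/
def descending : ℕ → List ℤ
  | 0 => []
  | n + 1 => ((n : ℤ) + 1) :: descending n

/-- The inequalities `0 ≤ z i` and `∑ i, z i ≤ 1`, where `I` is a list of distinct labels. -/
def simplexIneqs (k : ℕ) (I : List ℤ) : List ((Fin k → ℤ) × List ℤ × ℤ) :=
  (fun _ => 0, I.map fun _ => 1, 1) ::
    I.map fun i => (fun _ => 0, I.map fun j => if i = j then -1 else 0, 0)

/-- The vertex lists of the polyhedra of a list of rational systems. -/
def vertexLists {d : ℕ} (L : List (List ((Fin d → ℚ) × ℚ))) : List (List (Fin (d + 1) → ℤ)) :=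
  L.map fun S => vertexList (S.map homRow)

/-- The facet-describing system of the disjunction hull. -/
def facetIneqs {e : ℕ} (L : List (List ((Fin (e + 1) → ℚ) × ℚ))) :
    List ((Fin (e + 1) → ℤ) × List ℤ × ℤ) :=
  simplexIneqs (e + 1) (descending L.tail.length) ++
    ((normals (pointLists (vertexLists L))).pwFilter fun c c' => ¬SameDir c c').map
      (supportIneq (denominators (vertexLists L)).prod (pointLists (vertexLists L)))

/-! ### The algorithm runs in polynomial time -/

section

variable {α β γ δ σ : Type} [Enc α] [Enc β] [Enc γ] [Enc δ] [Enc σ]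

/-- For fixed `k` the Leibniz formula has constantly many terms. -/
theorem PolyTime.det {k : ℕ} {M : δ → Matrix (Fin k) (Fin k) ℤ}
    (hM : ∀ i j, PolyTime fun x => M x i j) : PolyTime fun x => (M x).det := by
  simp only [Matrix.det_apply']
  exact PolyTime.finset_sum _ fun s _ => (PolyTime.const _).int_mul
    (PolyTime.finset_prod _ fun i _ => hM _ _)

theorem PolyTime.cross {k : ℕ} {t : δ → Fin k → Fin (k + 1) → ℤ}
    (ht : ∀ i j, PolyTime fun x => t x i j) : PolyTime fun x => cross (t x) := by
  refine PolyTime.tuple fun j => PolyTime.det fun i l => ?_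
  cases i using Fin.cases with
  | zero => exact PolyTime.const _
  | succ i => exact ht i l

@[fun_prop]
theorem PolyTime.dotProduct {k : ℕ} {u v : δ → Fin k → ℤ} (hu : PolyTime u) (hv : PolyTime v) :
    PolyTime fun x => u x ⬝ᵥ v x :=
  PolyTime.finset_sum _ fun j _ => (hu.apply j).int_mul (hv.apply j)

theorem polyTime_homRow {d : ℕ} : PolyTime (homRow (d := d)) := by
  have h : ∀ j, PolyTime fun q : (Fin d → ℚ) × ℚ =>
      (Fin.cons q.2 q.1 : Fin (d + 1) → ℚ) j := by
    intro j
    cases j using Fin.cases with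
    | zero => exact polyTime_snd
    | succ j => exact polyTime_fst.apply j
  have h' : ∀ j, PolyTime fun q : (Fin d → ℚ) × ℚ =>
      clearDen (Fin.cons q.2 q.1 : Fin (d + 1) → ℚ) j := fun j =>
    (h j).rat_num.int_mul (PolyTime.finset_prod _ fun i _ => (h i).rat_den)
  refine PolyTime.tuple fun j => ?_
  cases j using Fin.cases with
  | zero => exact (h' 0).int_neg
  | succ j => exact h' j.succ

theorem polyTime_vertexList {d : ℕ} : PolyTime (vertexList (d := d)) := by
  refine PolyTime.filter (p := fun rows (y : Fin (d + 1) → ℤ) => decide (0 < y 0 ∧ ∀ r ∈ rows, r ⬝ᵥ y ≤ 0)) ?_ ?_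
  · refine PolyTime.decide_and ?_ ?_
    · exact (PolyTime.const 0).int_lt (polyTime_snd.apply 0)
    · exact PolyTime.decide_forall_mem
        (p := fun (y : List (Fin (d + 1) → ℤ) × (Fin (d + 1) → ℤ)) r => r ⬝ᵥ y.2 ≤ 0)
        (by fun_prop) (by fun_prop)
  · refine PolyTime.list_map (f := fun (_ : List (Fin (d + 1) → ℤ)) (t : Fin d → Fin (d + 1) → ℤ) j =>
      DisjHull.cross t 0 * DisjHull.cross t j) ?_
      (polyTime_tuples d)
    have h : PolyTime fun y : List (Fin (d + 1) → ℤ) × (Fin d → Fin (d + 1) → ℤ) =>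
        DisjHull.cross y.2 := PolyTime.cross fun i j => (polyTime_snd.apply i).apply j
    exact PolyTime.tuple fun j => (h.apply 0).int_mul (h.apply j)

theorem polyTime_denominators {d : ℕ} : PolyTime (denominators (d := d)) := by
  refine PolyTime.pwFilter (by fun_prop) ?_
  exact PolyTime.list_map (f := fun (_ : List (List (Fin (d + 1) → ℤ))) (y : Fin (d + 1) → ℤ) => y 0) (polyTime_snd.apply 0) (by fun_prop)

theorem polyTime_rescale {d : ℕ} :
    PolyTime fun x : List ℤ × (Fin (d + 1) → ℤ) => rescale x.1 x.2 := by
  refine PolyTime.tuple fun j => (polyTime_snd.apply j.succ).int_mul (PolyTime.list_prod ?_)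
  refine PolyTime.filter (p := fun (x : List ℤ × (Fin (d + 1) → ℤ)) z => decide (z ≠ x.2 0)) ?_
    (by fun_prop)
  exact (polyTime_snd.int_eq (polyTime_fst.snd.apply 0)).decide_not

theorem polyTime_pointLists {d : ℕ} : PolyTime (pointLists (d := d)) := by
  refine PolyTime.list_map (f := fun W (V : List (Fin (d + 1) → ℤ)) => V.map (rescale (denominators W))) ?_ .id
  refine PolyTime.list_map (f := fun (y : List (List (Fin (d + 1) → ℤ)) × List (Fin (d + 1) → ℤ)) =>
    rescale (denominators y.1)) ?_ polyTime_snd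
  exact polyTime_rescale.comp ((polyTime_denominators.comp polyTime_fst.fst).prodMk polyTime_snd)

theorem polyTime_pointPairs : PolyTime (pointPairs (α := α)) := by
  refine PolyTime.flatMap (f := fun (_ : List (List α)) (V : List α) =>
    V.flatMap fun u => V.map fun u' => (V, u, u')) ?_ .id
  refine PolyTime.flatMap (f := fun (y : List (List α) × List α) u =>
    y.2.map fun u' => (y.2, u, u')) ?_ polyTime_snd
  exact PolyTime.list_map (f := fun (y : (List (List α) × List α) × α) u' => (y.1.2, y.2, u'))
    (by fun_prop) (by fun_prop)

theorem polyTime_normals {e : ℕ} : PolyTime (normals (e := e)) := by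
  let T := Fin e → List (Fin (e + 1) → ℤ) × (Fin (e + 1) → ℤ) × (Fin (e + 1) → ℤ)
  refine PolyTime.list_map (f := fun (_ : List (List (Fin (e + 1) → ℤ)))
    (y : T × (Fin (e + 1) → ℤ)) => y.2) polyTime_snd.snd ?_
  refine PolyTime.filter (p := fun (_ : List (List (Fin (e + 1) → ℤ)))
    (y : T × (Fin (e + 1) → ℤ)) => decide ((¬∀ j, y.2 j = 0) ∧ ∀ j, ∀ w ∈ (y.1 j).1,
        y.2 ⬝ᵥ w ≤ y.2 ⬝ᵥ (y.1 j).2.1)) ?_ ?_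
  · refine PolyTime.decide_and (PolyTime.decide_not (PolyTime.decide_forall fun j => ?_))
      (PolyTime.decide_forall fun j => ?_)
    · exact (polyTime_snd.snd.apply j).int_eq (.const 0)
    · refine PolyTime.decide_forall_mem (p := fun (y : List (List (Fin (e + 1) → ℤ)) ×
        T × (Fin (e + 1) → ℤ)) w => y.2.2 ⬝ᵥ w ≤ y.2.2 ⬝ᵥ (y.2.1 j).2.1) ?_ ?_
      · exact PolyTime.int_le (by fun_prop)
          (PolyTime.dotProduct (by fun_prop) (polyTime_fst.snd.fst.apply j).snd.fst)
      · exact (polyTime_snd.fst.apply j).fst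
  · refine PolyTime.flatMap (f := fun (_ : List (List (Fin (e + 1) → ℤ))) (t : T) =>
      [(t, DisjHull.cross fun j => (t j).2.1 - (t j).2.2),
      (t, -DisjHull.cross fun j => (t j).2.1 - (t j).2.2)]) ?_ (polyTime_pointPairs.tuples e)
    have h : PolyTime fun y : List (List (Fin (e + 1) → ℤ)) ×
        T =>
        DisjHull.cross fun j => (y.2 j).2.1 - (y.2 j).2.2 :=
      PolyTime.cross fun i j => ((polyTime_snd.apply i).snd.fst.apply j).int_sub
        ((polyTime_snd.apply i).snd.snd.apply j)
    have h' : PolyTime fun y : List (List (Fin (e + 1) → ℤ)) ×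
        T =>
        -DisjHull.cross fun j => (y.2 j).2.1 - (y.2 j).2.2 :=
      PolyTime.tuple fun j => (h.apply j).int_neg
    exact (polyTime_snd.prodMk h).cons ((polyTime_snd.prodMk h').cons (PolyTime.const []))

theorem polyTime_sameDir {k : ℕ} :
    PolyTime fun y : (Fin k → ℤ) × (Fin k → ℤ) => decide (SameDir y.1 y.2) :=
  PolyTime.decide_and (PolyTime.int_eq (by fun_prop) (by fun_prop))
    (PolyTime.int_lt (by fun_prop) (by fun_prop))

theorem PolyTime.support {k : ℕ} {c : δ → Fin k → ℤ} {V : δ → List (Fin k → ℤ)} (hc : PolyTime c)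
    (hV : PolyTime V) : PolyTime fun x => support (c x) (V x) :=
  PolyTime.listMax (PolyTime.list_map (f := fun x u => c x ⬝ᵥ u) (by fun_prop) hV)

theorem polyTime_supportIneq {k : ℕ} :
    PolyTime fun x : (ℤ × List (List (Fin k → ℤ))) × (Fin k → ℤ) =>
      supportIneq x.1.1 x.1.2 x.2 := by
  have h : PolyTime fun x : (ℤ × List (List (Fin k → ℤ))) × (Fin k → ℤ) =>
      DisjHull.support x.2 (x.1.2.headD []) := PolyTime.support (by fun_prop) (by fun_prop)
  refine PolyTime.prodMk (PolyTime.tuple fun j => ?_) (PolyTime.prodMk ?_ h)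
  · exact PolyTime.int_mul (by fun_prop) (polyTime_snd.apply j)
  · refine PolyTime.list_map (f := fun (x : (ℤ × List (List (Fin k → ℤ))) × (Fin k → ℤ)) V =>
      DisjHull.support x.2 (x.1.2.headD []) - DisjHull.support x.2 V) ?_ (by fun_prop)
    exact (h.comp polyTime_fst).int_sub (PolyTime.support (by fun_prop) (by fun_prop))

theorem headD_descending (n : ℕ) : (descending n).headD 0 = n := by
  cases n <;> simp [descending]

/-- The input does not contain `n` as a number, so the labels of the layers are produced while
walking along the list of systems. -/
theorem foldl_descending {α : Type} (l : List α) :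
    l.foldl (fun s _ => (s.headD 0 + 1) :: s) [] = descending l.length := by
  induction l using List.reverseRecOn with
  | nil => rfl
  | append_singleton l a ih =>
    rw [List.foldl_append, ih]
    simp only [List.foldl_cons, List.foldl_nil, headD_descending]
    simp [descending]

theorem size_enc_descending_le (n : ℕ) : (enc (descending n)).size ≤ n * (n + 2) + 1 := by
  induction n with
  | zero => simp [descending, size_enc_nil]
  | succ n ih =>
    have h : ((n : ℤ) + 1).natAbs.size ≤ n + 1 := by
      rw [Nat.size_le]
      have : ((n : ℤ) + 1).natAbs = n + 1 := by omega
      rw [this]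
      exact Nat.lt_two_pow_self
    rw [descending, size_enc_cons, size_enc_int]
    nlinarith

theorem PolyTime.descending {l : δ → List α} (hl : PolyTime l) :
    PolyTime fun x => descending (l x).length := by
  simp only [← foldl_descending]
  refine PolyTime.foldl (step := fun y : δ × List ℤ × α => (y.2.1.headD 0 + 1) :: y.2.1)
    (PolyTime.const []) hl ?_ ((hl.polyBound_size.mul (hl.polyBound_size.add (.const 2))).add
      (.const 1)) fun x k hk => ?_
  · exact PolyTime.cons (PolyTime.int_add (PolyTime.headD (by fun_prop) 0) (by fun_prop))
      (by fun_prop)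
  · have h := length_lt_size_enc k
    have h' := size_enc_le_of_sublist hk.sublist
    dsimp only
    rw [foldl_descending]
    refine (size_enc_descending_le _).trans ?_
    gcongr <;> omega

theorem polyTime_simplexIneqs (k : ℕ) : PolyTime (simplexIneqs k) := by
  refine PolyTime.cons (PolyTime.prodMk (PolyTime.const _) (PolyTime.prodMk ?_ (PolyTime.const _)))
    (PolyTime.list_map (f := fun (I : List ℤ) (i : ℤ) => ((fun _ => 0 : Fin k → ℤ),
      I.map fun j => if i = j then (-1 : ℤ) else 0, (0 : ℤ)))
      (PolyTime.prodMk (PolyTime.const _) (PolyTime.prodMk ?_ (PolyTime.const _))) .id)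
  · exact PolyTime.list_map (f := fun (_ : List ℤ) (_ : ℤ) => (1 : ℤ)) (PolyTime.const _) .id
  · exact PolyTime.list_map (f := fun (y : List ℤ × ℤ) j => if y.2 = j then (-1 : ℤ) else 0)
      (PolyTime.ite (PolyTime.int_eq (by fun_prop) (by fun_prop)) (by fun_prop) (by fun_prop))
      (by fun_prop)

theorem polyTime_vertexLists {d : ℕ} : PolyTime (vertexLists (d := d)) := by
  have h : PolyTime fun S : List ((Fin d → ℚ) × ℚ) => S.map homRow :=
    PolyTime.list_map (f := fun (_ : List ((Fin d → ℚ) × ℚ)) => homRow)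
      (polyTime_homRow.comp polyTime_snd) .id
  exact PolyTime.list_map (f := fun (_ : List (List ((Fin d → ℚ) × ℚ)))
    (S : List ((Fin d → ℚ) × ℚ)) => vertexList (S.map homRow))
      ((polyTime_vertexList.comp h).comp polyTime_snd) .id

theorem polyTime_facetIneqs {e : ℕ} : PolyTime (facetIneqs (e := e)) := by
  have hW := polyTime_vertexLists (d := e + 1)
  have hU := polyTime_pointLists.comp hW
  have hQ := (polyTime_denominators.comp hW).list_prod
  have hI : PolyTime fun L : List (List ((Fin (e + 1) → ℚ) × ℚ)) =>
    simplexIneqs (e + 1) (descending L.tail.length) :=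
    (polyTime_simplexIneqs (e + 1)).comp (PolyTime.id.tail.descending)
  have hN : PolyTime fun L : List (List ((Fin (e + 1) → ℚ) × ℚ)) =>
      (normals (pointLists (vertexLists L))).pwFilter fun c c' => ¬SameDir c c' :=
    PolyTime.pwFilter polyTime_sameDir.decide_not (polyTime_normals.comp hU)
  have hS : PolyTime fun y : List (List ((Fin (e + 1) → ℚ) × ℚ)) × (Fin (e + 1) → ℤ) =>
      supportIneq (denominators (vertexLists y.1)).prod (pointLists (vertexLists y.1)) y.2 :=
    polyTime_supportIneq.comp
      (((hQ.comp polyTime_fst).prodMk (hU.comp polyTime_fst)).prodMk polyTime_snd)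
  unfold facetIneqs
  exact hI.append (PolyTime.list_map (f := fun (L : List (List ((Fin (e + 1) → ℚ) × ℚ))) =>
    supportIneq (denominators (vertexLists L)).prod (pointLists (vertexLists L))) hS hN)

end

/-! ## Linear algebra -/

/-- The coordinates of `cross t` are the cofactors in the Laplace expansion along the first row. -/
theorem dotProduct_cross {R : Type*} [CommRing R] {k : ℕ} (t : Fin k → Fin (k + 1) → R)
    (y : Fin (k + 1) → R) :
    y ⬝ᵥ cross t = (Matrix.of (Fin.cons y t : Fin (k + 1) → Fin (k + 1) → R)).det := by
  have h : ∀ z : Fin (k + 1) → R,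
      (Matrix.of (Fin.cons z t : Fin (k + 1) → Fin (k + 1) → R)).det =
      ∑ j : Fin (k + 1), (-1) ^ (j : ℕ) * z j *
        (Matrix.of fun i l => t i (j.succAbove l)).det := by
    intro z
    rw [Matrix.det_succ_row_zero]
    rfl
  rw [h, dotProduct]
  refine Finset.sum_congr rfl fun j _ => ?_
  rw [cross, h, Finset.sum_eq_single j]
  · simp; ring
  · intro l _ hl
    simp [hl]
  · simp

theorem dotProduct_cross_self {R : Type*} [CommRing R] {k : ℕ} (t : Fin k → Fin (k + 1) → R)
    (i : Fin k) : t i ⬝ᵥ cross t = 0 := by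
  rw [dotProduct_cross]
  exact Matrix.det_zero_of_row_eq (i := 0) (j := i.succ) (Fin.succ_ne_zero i).symm (by rfl)

theorem cross_map {R S : Type*} [CommRing R] [CommRing S] (φ : R →+* S) {k : ℕ}
    (t : Fin k → Fin (k + 1) → R) (j : Fin (k + 1)) :
    cross (fun i l => φ (t i l)) j = φ (cross t j) := by
  rw [cross, cross, RingHom.map_det]
  congr 1
  ext i l
  cases i using Fin.cases with
  | zero => by_cases h : l = j <;> simp [h]
  | succ i => simp

/-- A nonzero coordinate is the determinant of an invertible matrix that contains the rows `t`.
Conversely, independent rows extend by a vector `y` outside their span to an invertible matrix,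
whose determinant is `y ⬝ᵥ cross t`. -/
theorem cross_ne_zero_iff {K : Type*} [Field K] {k : ℕ} (t : Fin k → Fin (k + 1) → K) :
    cross t ≠ 0 ↔ LinearIndependent K t := by
  constructor
  · intro h
    obtain ⟨j, hj⟩ := Function.ne_iff.1 h
    have := (Matrix.linearIndependent_rows_iff_isUnit
      (A := Matrix.of (Fin.cons (Pi.single j 1) t : Fin (k + 1) → Fin (k + 1) → K))).2
      ((Matrix.isUnit_iff_isUnit_det _).2 (isUnit_iff_ne_zero.2 hj))
    exact this.comp Fin.succ (Fin.succ_injective k)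
  · intro h h0
    have hlt : Submodule.span K (Set.range t) < ⊤ := by
      refine Submodule.lt_top_of_finrank_lt_finrank ?_
      rw [finrank_span_eq_card h]
      simp
    obtain ⟨y, -, hy⟩ := SetLike.exists_of_lt hlt
    have hc : LinearIndependent K (Fin.cons y t : Fin (k + 1) → Fin (k + 1) → K) :=
      linearIndependent_finCons.2 ⟨h, hy⟩
    have hu := (Matrix.isUnit_iff_isUnit_det _).1 ((Matrix.linearIndependent_rows_iff_isUnit
      (A := Matrix.of (Fin.cons y t : Fin (k + 1) → Fin (k + 1) → K))).1 hc)
    rw [← dotProduct_cross, h0, dotProduct_zero] at hu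
    exact not_isUnit_zero hu

section Dual

variable {K E : Type*} [Field K] [AddCommGroup E] [Module K E] [FiniteDimensional K E]

/-- Codimension one means that the annihilator is a line. This turns the dimension of a facet into a
statement about functionals. -/
theorem finrank_add_one_eq_iff (W : Submodule K E) {f : Module.Dual K E} (hf : f ≠ 0)
    (hfW : f ∈ W.dualAnnihilator) :
    Module.finrank K W + 1 = Module.finrank K E ↔
      ∀ g ∈ W.dualAnnihilator, ∃ c : K, g = c • f := by
  have h := Subspace.finrank_add_finrank_dualAnnihilator_eq W
  have h1 := finrank_eq_one_iff_of_nonzero' (K := K) (⟨f, hfW⟩ : W.dualAnnihilator)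
    (by simpa [Subtype.ext_iff] using hf)
  have h2 : Module.finrank K W + 1 = Module.finrank K E ↔
      Module.finrank K W.dualAnnihilator = 1 := by omega
  rw [h2, h1]
  simp only [Subtype.forall, Subtype.ext_iff, SetLike.val_smul, eq_comm]

theorem finrank_eq_iff (W : Submodule K E) :
    Module.finrank K W = Module.finrank K E ↔ ∀ g ∈ W.dualAnnihilator, g = 0 := by
  have h := Subspace.finrank_add_finrank_dualAnnihilator_eq W
  have h2 : Module.finrank K W = Module.finrank K E ↔
      Module.finrank K W.dualAnnihilator = 0 := by omega
  rw [h2, Submodule.finrank_eq_zero, Submodule.eq_bot_iff]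

end Dual

theorem dotProductEquiv_mem_dualAnnihilator {k : ℕ} (s : Set (Fin k → ℝ)) (w : Fin k → ℝ) :
    dotProductEquiv ℝ (Fin k) w ∈ (Submodule.span ℝ s).dualAnnihilator ↔
      ∀ t ∈ s, t ⬝ᵥ w = 0 := by
  rw [Submodule.mem_dualAnnihilator]
  constructor
  · intro h t ht
    rw [dotProduct_comm]
    exact h t (Submodule.subset_span ht)
  · intro h x hx
    induction hx using Submodule.span_induction with
    | mem x hx => simpa [dotProduct_comm] using h x hx
    | zero => simp
    | add x y _ _ hx hy => rw [map_add, hx, hy, add_zero]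
    | smul a x _ hx => rw [map_smul, hx, smul_zero]

/-- The orthogonal complement of a set of vectors is spanned by `y ≠ 0` if and only if the span of
the set is a hyperplane. -/
theorem finrank_span_add_one_eq_iff {k : ℕ} (s : Set (Fin (k + 1) → ℝ)) {y : Fin (k + 1) → ℝ}
    (hy : y ≠ 0) (hs : ∀ t ∈ s, t ⬝ᵥ y = 0) :
    Module.finrank ℝ (Submodule.span ℝ s) = k ↔
      ∀ w, (∀ t ∈ s, t ⬝ᵥ w = 0) → ∃ c : ℝ, w = c • y := by
  have h := finrank_add_one_eq_iff (Submodule.span ℝ s)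
    (f := dotProductEquiv ℝ (Fin (k + 1)) y) (by simpa using hy)
    ((dotProductEquiv_mem_dualAnnihilator s y).2 hs)
  rw [Module.finrank_fin_fun, add_left_inj] at h
  rw [h, (dotProductEquiv ℝ (Fin (k + 1))).surjective.forall]
  simp only [dotProductEquiv_mem_dualAnnihilator, ← map_smul, EmbeddingLike.apply_eq_iff_eq]

theorem eq_smul_cross {k : ℕ} {t : Fin k → Fin (k + 1) → ℝ} (ht : cross t ≠ 0)
    {w : Fin (k + 1) → ℝ} (hw : ∀ i, t i ⬝ᵥ w = 0) : ∃ c : ℝ, w = c • cross t := by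
  refine (finrank_span_add_one_eq_iff (Set.range t) ht ?_).1 ?_ w ?_
  · rintro _ ⟨i, rfl⟩
    exact dotProduct_cross_self t i
  · rw [finrank_span_eq_card ((cross_ne_zero_iff t).1 ht)]
    simp
  · rintro _ ⟨i, rfl⟩
    exact hw i

/-- The span of `s` is a hyperplane, so `s` contains a basis of it with `k` elements; the cross
product of the basis and `y` lie on the same orthogonal line. It is used for vertices, with `s` the
tight rows, and for facet normals, with `s` the differences of tight points. -/
theorem exists_cross_eq_smul {k : ℕ} (s : Set (Fin (k + 1) → ℝ)) {y : Fin (k + 1) → ℝ}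
    (hy : y ≠ 0) (hs : ∀ t ∈ s, t ⬝ᵥ y = 0)
    (h : ∀ w, (∀ t ∈ s, t ⬝ᵥ w = 0) → ∃ c : ℝ, w = c • y) :
    ∃ t : Fin k → Fin (k + 1) → ℝ, (∀ i, t i ∈ s) ∧ ∃ c : ℝ, c ≠ 0 ∧ cross t = c • y := by
  have hk := (finrank_span_add_one_eq_iff s hy hs).2 h
  obtain ⟨b, hbs, hspan, hb⟩ := exists_linearIndependent ℝ s
  have hfin : Finite b := hb.finite
  have := Fintype.ofFinite b
  have hcard : Fintype.card b = k := by
    rw [← finrank_span_eq_card hb, Subtype.range_coe, hspan, hk]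
  let φ : Fin k ≃ b := (Fintype.equivFinOfCardEq hcard).symm
  have ht : LinearIndependent ℝ fun i => (φ i : Fin (k + 1) → ℝ) := hb.comp φ φ.injective
  refine ⟨fun i => φ i, fun i => hbs (φ i).2, ?_⟩
  have h0 := (cross_ne_zero_iff _).2 ht
  obtain ⟨c, hc⟩ := eq_smul_cross h0 (w := y) fun i => hs _ (hbs (φ i).2)
  have hc0 : c ≠ 0 := by
    rintro rfl
    exact hy (by simpa using hc)
  exact ⟨c⁻¹, inv_ne_zero hc0, by rw [hc, smul_smul, inv_mul_cancel₀ hc0, one_smul]⟩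

/-! ## Convex geometry -/

section Polyhedral

variable {E : Type*} [AddCommGroup E] [Module ℝ E]

/-- Otherwise `x ± ε • w` are both feasible for small `ε`: tight constraints do not change along
`w`, and the finitely many others have slack. -/
theorem eq_zero_of_mem_extremePoints {ι : Type*} [Finite ι] {a : ι → E →ₗ[ℝ] ℝ} {b : ι → ℝ} {x : E}
    (hx : x ∈ Set.extremePoints ℝ {x | ∀ i, a i x ≤ b i}) {w : E}
    (hw : ∀ i, a i x = b i → a i w = 0) : w = 0 := by
  obtain ⟨hxS, hext⟩ := hx
  have hev : ∀ᶠ ε : ℝ in nhdsWithin 0 (Set.Ioi 0), ∀ i, ε * |a i w| ≤ b i - a i x := by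
    rw [Filter.eventually_all]
    intro i
    rcases (hxS i).eq_or_lt with h | h
    · simp [hw i h, h]
    · have ht : Filter.Tendsto (fun ε : ℝ => ε * |a i w|) (nhdsWithin 0 (Set.Ioi 0)) (nhds 0) := by
        have : Filter.Tendsto (fun ε : ℝ => ε * |a i w|) (nhds 0) (nhds (0 * |a i w|)) :=
          (continuous_id.mul continuous_const).tendsto 0
        rw [zero_mul] at this
        exact this.mono_left nhdsWithin_le_nhds
      exact (ht.eventually (gt_mem_nhds (sub_pos.2 h))).mono fun ε hε => hε.le
  obtain ⟨ε, hε, hε0⟩ := (hev.and self_mem_nhdsWithin).exists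
  have hε0 : 0 < ε := hε0
  have h1 : x + ε • w ∈ {x | ∀ i, a i x ≤ b i} := fun i => by
    have := mul_le_mul_of_nonneg_left (le_abs_self (a i w)) hε0.le
    have := hε i
    simp only [map_add, map_smul, smul_eq_mul]
    linarith
  have h2 : x - ε • w ∈ {x | ∀ i, a i x ≤ b i} := fun i => by
    have := mul_le_mul_of_nonneg_left (neg_abs_le (a i w)) hε0.le
    have := hε i
    simp only [map_sub, map_smul, smul_eq_mul]
    linarith
  have h3 : x ∈ openSegment ℝ (x + ε • w) (x - ε • w) :=
    ⟨1 / 2, 1 / 2, by norm_num, by norm_num, by norm_num, by module⟩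
  have h4 := hext h1 h2 h3
  have h5 : ε • w = 0 := by simpa using h4
  exact (smul_eq_zero.1 h5).resolve_left hε0.ne'

theorem mem_dualAnnihilator_vectorSpan {S : Set E} {x₀ : E} (hx₀ : x₀ ∈ S) (g : Module.Dual ℝ E) :
    g ∈ (vectorSpan ℝ S).dualAnnihilator ↔ ∀ x ∈ S, g x = g x₀ := by
  rw [Submodule.mem_dualAnnihilator]
  constructor
  · intro h x hx
    have := h _ (vsub_mem_vectorSpan ℝ hx hx₀)
    rwa [vsub_eq_sub, map_sub, sub_eq_zero] at this
  · intro h w hw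
    have : vectorSpan ℝ S ≤ LinearMap.ker g := by
      rw [vectorSpan_def, Submodule.span_le]
      rintro _ ⟨x, hx, y, hy, rfl⟩
      simp [h x hx, h y hy]
    exact this hw

/-- The points strictly below `β`, together with the hull of the tight generators on the level `β`,
form a convex set containing `G`. -/
theorem face_convexHull_subset {G : Set E} {f : E →ₗ[ℝ] ℝ} {β : ℝ} (hv : ∀ x ∈ G, f x ≤ β) :
    face (convexHull ℝ G) f β ⊆ convexHull ℝ {x ∈ G | f x = β} := by
  have hconv : Convex ℝ {x | f x < β ∨ (f x = β ∧ x ∈ convexHull ℝ {x ∈ G | f x = β})} := by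
    intro x hx y hy a b ha hb hab
    rcases ha.eq_or_lt with rfl | ha'
    · simpa [show b = 1 by linarith] using hy
    rcases hb.eq_or_lt with rfl | hb'
    · simpa [show a = 1 by linarith] using hx
    have hβ : β = a * β + b * β := by rw [← add_mul, hab, one_mul]
    simp only [Set.mem_ofPred_eq, map_add, map_smul, smul_eq_mul]
    rcases hx with hx | ⟨hx, hx'⟩
    · left
      have hy : f y ≤ β := hy.elim le_of_lt fun h => h.1.le
      nlinarith
    · rcases hy with hy | ⟨hy, hy'⟩
      · left
        nlinarith
      · right
        exact ⟨by rw [hx, hy, ← hβ], convex_convexHull ℝ _ hx' hy' ha hb hab⟩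
  have hsub := convexHull_min (fun x hx => ?_) hconv (s := G)
  · rintro x ⟨hx, hx'⟩
    rcases hsub hx with h | h
    · exact absurd hx' h.ne
    · exact h.2
  · rcases (hv x hx).lt_or_eq with h | h
    · exact Or.inl h
    · exact Or.inr ⟨h, subset_convexHull ℝ _ ⟨hx, h⟩⟩

theorem eq_on_convexHull {G : Set E} {g : E →ₗ[ℝ] ℝ} {γ : ℝ} (h : ∀ x ∈ G, g x = γ) :
    ∀ x ∈ convexHull ℝ G, g x = γ :=
  convexHull_min (t := {x | g x = γ}) h (convex_hyperplane g.isLinear γ)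

theorem valid_convexHull {G : Set E} {g : E →ₗ[ℝ] ℝ} {γ : ℝ} (h : ∀ x ∈ G, g x ≤ γ) :
    Valid (convexHull ℝ G) g γ :=
  convexHull_min (t := {x | g x ≤ γ}) h (convex_halfSpace_le g.isLinear γ)

variable [FiniteDimensional ℝ E]

theorem polyDim_eq_finrank_iff {S : Set E} (hS : S.Nonempty) :
    polyDim S = Module.finrank ℝ E ↔
      ∀ (g : E →ₗ[ℝ] ℝ) (γ : ℝ), (∀ x ∈ S, g x = γ) → g = 0 := by
  obtain ⟨x₀, hx₀⟩ := hS
  rw [polyDim, if_neg (Set.nonempty_iff_ne_empty.1 ⟨x₀, hx₀⟩), Nat.cast_inj, finrank_eq_iff]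
  simp only [mem_dualAnnihilator_vectorSpan hx₀]
  exact ⟨fun h g γ hg => h g fun x hx => (hg x hx).trans (hg x₀ hx₀).symm, fun h g hg => h g _ hg⟩

/-- The working form of the facet condition: up to scaling, `f` is the only functional that is
constant on the face. -/
theorem describesFacet_iff {S : Set E} (hS : polyDim S = Module.finrank ℝ E)
    (hE : 1 ≤ Module.finrank ℝ E) {f : E →ₗ[ℝ] ℝ} {β : ℝ} :
    DescribesFacet S f β ↔ Valid S f β ∧ f ≠ 0 ∧ (face S f β).Nonempty ∧
      ∀ (g : E →ₗ[ℝ] ℝ) (γ : ℝ), (∀ x ∈ face S f β, g x = γ) → ∃ c : ℝ, g = c • f := by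
  rw [DescribesFacet]
  refine and_congr_right fun hv => ?_
  rw [hS]
  -- The empty face has dimension `-1`, which would be the facet dimension in a space of dimension
  -- `0`; `hE` excludes this.
  have hne : polyDim (face S f β) = (Module.finrank ℝ E : ℤ) - 1 → (face S f β).Nonempty := by
    intro h
    by_contra h'
    rw [Set.not_nonempty_iff_eq_empty] at h'
    rw [h', polyDim, if_pos rfl] at h
    omega
  have hf0 : polyDim (face S f β) = (Module.finrank ℝ E : ℤ) - 1 → f ≠ 0 := by
    intro h hf
    obtain ⟨x, hx, hx'⟩ := hne h
    have : face S f β = S := by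
      refine Set.sep_eq_self_iff_mem_true.2 fun y _ => ?_
      rw [← hx', hf]
      rfl
    rw [this, hS] at h
    omega
  suffices ∀ x₀ ∈ face S f β, f ≠ 0 → (polyDim (face S f β) = (Module.finrank ℝ E : ℤ) - 1 ↔
      ∀ (g : E →ₗ[ℝ] ℝ) (γ : ℝ), (∀ x ∈ face S f β, g x = γ) → ∃ c : ℝ, g = c • f) by
    constructor
    · intro h
      obtain ⟨x₀, hx₀⟩ := hne h
      exact ⟨hf0 h, ⟨x₀, hx₀⟩, (this x₀ hx₀ (hf0 h)).1 h⟩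
    · rintro ⟨h, ⟨x₀, hx₀⟩, h'⟩
      exact (this x₀ hx₀ h).2 h'
  intro x₀ hx₀ hf
  have h := finrank_add_one_eq_iff (vectorSpan ℝ (face S f β)) hf
    ((mem_dualAnnihilator_vectorSpan hx₀ f).2 fun x hx => hx.2.trans hx₀.2.symm)
  rw [polyDim, if_neg (Set.nonempty_iff_ne_empty.1 ⟨x₀, hx₀⟩), eq_sub_iff_add_eq]
  norm_cast
  rw [h]
  simp only [mem_dualAnnihilator_vectorSpan hx₀]
  exact ⟨fun h g γ hg => h g fun x hx => (hg x hx).trans (hg x₀ hx₀).symm, fun h g hg => h g _ hg⟩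

/-- An inequality that is tight on a facet is a positive multiple of the inequality describing it. -/
theorem DescribesFacet.exists_pos_smul {S : Set E} (hS : polyDim S = Module.finrank ℝ E)
    (hE : 1 ≤ Module.finrank ℝ E) {f g : E →ₗ[ℝ] ℝ} {β γ : ℝ} (hf : DescribesFacet S f β)
    (hg : Valid S g γ) (hg0 : g ≠ 0) (hfg : ∀ x ∈ face S f β, g x = γ) :
    ∃ c : ℝ, 0 < c ∧ g = c • f ∧ γ = c * β := by
  obtain ⟨hv, hf0, ⟨x₀, hx₀⟩, h⟩ := (describesFacet_iff hS hE).1 hf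
  obtain ⟨c, rfl⟩ := h g γ hfg
  have hγ : γ = c * β := by rw [← hfg x₀ hx₀, ← hx₀.2]; rfl
  refine ⟨c, ?_, rfl, hγ⟩
  by_contra hc
  have hc0 : c ≠ 0 := by
    rintro rfl
    exact hg0 (zero_smul _ _)
  -- With a negative factor both `f ≤ β` and `f ≥ β` hold on `S`, which then lies in a hyperplane.
  have hneg : c < 0 := lt_of_le_of_ne (not_lt.1 hc) hc0
  have hne : S.Nonempty := ⟨x₀, hx₀.1⟩
  refine hf0 ((polyDim_eq_finrank_iff hne).1 hS f β fun x hx => ?_)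
  have h1 := hv x hx
  have h2 : c * f x ≤ c * β := by simpa [hγ] using hg x hx
  exact le_antisymm h1 ((mul_le_mul_left_of_neg hneg).1 h2)

end Polyhedral

/-! ### The polar body and the facet description of a polytope -/

section Normed

variable {E : Type*} [NormedAddCommGroup E] [NormedSpace ℝ E] [FiniteDimensional ℝ E]

/-- A ball of radius `ε` around `q` lies in the hull of `G`, so the functionals are at most `1` on
the centred ball, which bounds their norms by `2 / ε`. -/
theorem isCompact_polar {S : Set E} {q : E} (hq : q ∈ interior S) {G : Set E}
    (hGS : S ⊆ convexHull ℝ G) : IsCompact {f : E →L[ℝ] ℝ | ∀ g : G, f (g - q) ≤ 1} := by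
  obtain ⟨ε, hε, hball⟩ := Metric.isOpen_iff.1 isOpen_interior q hq
  refine Metric.isCompact_of_isClosed_isBounded ?_ ?_
  · simp only [Set.ofPred_forall]
    exact isClosed_iInter fun g => isClosed_le (by fun_prop) continuous_const
  · refine (Metric.isBounded_iff_subset_closedBall 0).2 ⟨2 / ε, fun f hf => ?_⟩
    have h1 : ∀ v : E, ‖v‖ < ε → f v ≤ 1 := by
      intro v hv
      have hmem : q + v ∈ convexHull ℝ G :=
        hGS (interior_subset (hball (by simpa using hv)))
      have := valid_convexHull (G := G) (g := f.toLinearMap) (γ := 1 + f q) (fun x hx => by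
        have := hf ⟨x, hx⟩
        simp only [map_sub] at this
        simp only [ContinuousLinearMap.coe_coe]
        linarith) _ hmem
      simp only [ContinuousLinearMap.coe_coe, map_add] at this
      linarith
    rw [mem_closedBall_zero_iff]
    refine f.opNorm_le_bound (by positivity) fun v => ?_
    rcases eq_or_ne v 0 with rfl | hv
    · simp
    have hv' : 0 < ‖v‖ := norm_pos_iff.2 hv
    have hn : ‖(ε / 2 / ‖v‖) • v‖ < ε := by
      rw [norm_smul, Real.norm_of_nonneg (by positivity), div_mul_cancel₀ _ hv'.ne']
      linarith
    have h2 := h1 _ hn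
    have h3 := h1 (-((ε / 2 / ‖v‖) • v)) (by rwa [norm_neg])
    simp only [map_neg, map_smul, smul_eq_mul] at h2 h3
    have h4 : |ε / 2 / ‖v‖ * f v| ≤ 1 := abs_le.2 ⟨by linarith, h2⟩
    rw [abs_mul, abs_of_pos (by positivity)] at h4
    rw [Real.norm_eq_abs]
    calc |f v| = (2 / ε * ‖v‖) * (ε / 2 / ‖v‖ * |f v|) := by field_simp
      _ ≤ (2 / ε * ‖v‖) * 1 := by gcongr
      _ = _ := mul_one _

/-- A point outside a full-dimensional polytope violates an inequality that describes a facet. -/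
theorem exists_describesFacet_lt {G : Set E} (hG : G.Finite)
    (hS : polyDim (convexHull ℝ G) = Module.finrank ℝ E) (hE : 1 ≤ Module.finrank ℝ E) {p : E}
    (hp : p ∉ convexHull ℝ G) :
    ∃ (f : E →ₗ[ℝ] ℝ) (β : ℝ), DescribesFacet (convexHull ℝ G) f β ∧ β < f p := by
  have hne : (convexHull ℝ G).Nonempty := by
    by_contra h
    rw [Set.not_nonempty_iff_eq_empty] at h
    rw [h, polyDim, if_pos rfl] at hS
    omega
  have hspan : vectorSpan ℝ (convexHull ℝ G) = ⊤ := by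
    rw [polyDim, if_neg (Set.nonempty_iff_ne_empty.1 hne), Nat.cast_inj] at hS
    exact Submodule.eq_top_of_finrank_eq hS
  have hint : (interior (convexHull ℝ G)).Nonempty := by
    rw [(convex_convexHull ℝ G).interior_nonempty_iff_affineSpan_eq_top,
      AffineSubspace.affineSpan_eq_top_iff_vectorSpan_eq_top_of_nonempty ℝ E E hne]
    exact hspan
  obtain ⟨q, hq⟩ := hint
  have hqS := interior_subset hq
  have : Finite G := hG
  set polar : Set (E →L[ℝ] ℝ) := {f | ∀ g : G, f (g - q) ≤ 1} with hpol
  have hcomp : IsCompact polar := isCompact_polar hq subset_rfl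
  have hconv : Convex ℝ polar := by
    intro f hf f' hf' a b ha hb hab g
    have h1 := mul_le_mul_of_nonneg_left (hf g) ha
    have h2 := mul_le_mul_of_nonneg_left (hf' g) hb
    simp only [add_apply, smul_apply, smul_eq_mul]
    linarith
  obtain ⟨h, u, hu, hup⟩ := geometric_hahn_banach_closed_point (convex_convexHull ℝ G)
    (hG.isClosed_convexHull (𝕜 := ℝ)) hp
  have hqu := sub_pos.2 (hu q hqS)
  -- The separating functional, scaled into the polar body; its value at `p - q` exceeds `1`.
  have hmem : (u - h q)⁻¹ • h ∈ polar := by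
    intro g
    have := hu g (subset_convexHull ℝ G g.2)
    simp only [smul_apply, smul_eq_mul, map_sub]
    rw [← mul_sub, inv_mul_le_one₀ hqu]
    linarith
  -- By Krein–Milman, if all extreme points were at most `1` at `p - q`, so would be the whole polar
  -- body.
  obtain ⟨f, hf, hfp⟩ : ∃ f ∈ Set.extremePoints ℝ polar, 1 < f (p - q) := by
    by_contra! hall
    have hsub : polar ⊆ {f | f (p - q) ≤ 1} := by
      rw [← closure_convexHull_extremePoints hcomp hconv]
      refine closure_minimal (convexHull_min hall ?_) (isClosed_le (by fun_prop) continuous_const)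
      intro f hf f' hf' a b ha hb hab
      have h1 := mul_le_mul_of_nonneg_left hf ha
      have h2 := mul_le_mul_of_nonneg_left hf' hb
      simp only [Set.mem_ofPred_eq, add_apply,
        smul_apply, smul_eq_mul]
      linarith
    have := hsub hmem
    simp only [Set.mem_ofPred_eq, smul_apply, smul_eq_mul, map_sub] at this
    rw [← mul_sub, inv_mul_le_one₀ hqu] at this
    linarith
  -- Extremality of `f`: only `0` vanishes at all `g - q` with `g` tight. This yields both a
  -- nonempty face and, below, uniqueness of its functional.
  have hext : ∀ w : E →L[ℝ] ℝ, (∀ g ∈ G, f g = 1 + f q → w (g - q) = 0) → w = 0 := by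
    intro w hw
    refine eq_zero_of_mem_extremePoints (b := fun _ : G => 1) (a := fun g : G =>
      (ContinuousLinearMap.apply ℝ ℝ ((g : E) - q)).toLinearMap) hf fun g hg => ?_
    refine hw g g.2 ?_
    have : f g - f q = 1 := by simpa using hg
    linarith
  have hf0 : f ≠ 0 := by
    rintro rfl
    norm_num at hfp
  have hvG : ∀ x ∈ G, f x ≤ 1 + f q := fun x hx => by
    have := hf.1 ⟨x, hx⟩
    simp only [map_sub] at this
    linarith
  have hsubface : ∀ x ∈ G, f x = 1 + f q →
      x ∈ face (convexHull ℝ G) f.toLinearMap (1 + f q) :=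
    fun x hx hx' => ⟨subset_convexHull ℝ G hx, hx'⟩
  refine ⟨f.toLinearMap, 1 + f q, (describesFacet_iff hS hE).2 ⟨valid_convexHull hvG, ?_, ?_, ?_⟩,
    ?_⟩
  · intro h0
    exact hf0 (by ext x; exact LinearMap.congr_fun h0 x)
  · by_contra hempty
    rw [Set.not_nonempty_iff_eq_empty] at hempty
    refine hf0 (hext f fun g hg hg' => ?_)
    have := hsubface g hg hg'
    rw [hempty] at this
    exact this.elim
  · intro g γ hg
    -- On tight `x` both `g (x - q)` and `(γ - g q) * f (x - q)` equal `γ - g q`.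
    have hz := hext (LinearMap.toContinuousLinearMap g - (γ - g q) • f) fun x hx hx' => by
      have h1 := hg x (hsubface x hx hx')
      simp only [sub_apply, LinearMap.coe_toContinuousLinearMap',
        smul_apply, map_sub, smul_eq_mul, h1, hx']
      ring
    refine ⟨γ - g q, ?_⟩
    ext x
    have := DFunLike.congr_fun hz x
    simpa [sub_eq_zero] using this
  · simp only [map_sub] at hfp
    simp only [ContinuousLinearMap.coe_coe]
    linarith

end Normed

theorem eq_convexHull_of_extremePoints_subset {E : Type*} [NormedAddCommGroup E]
    [NormedSpace ℝ E] {S V : Set E} (hS : IsCompact S) (hconv : Convex ℝ S)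
    (hV : V.Finite) (hVS : V ⊆ S) (hext : Set.extremePoints ℝ S ⊆ V) : S = convexHull ℝ V := by
  refine subset_antisymm ?_ (convexHull_min hVS hconv)
  rw [← closure_convexHull_extremePoints hS hconv]
  exact closure_minimal (convexHull_mono hext) (hV.isClosed_convexHull (𝕜 := ℝ))

/-! ### Vertex enumeration in homogeneous coordinates -/

/-- The polyhedron `{x | ∀ r ∈ rows, r 0 + ∑ j, r (j + 1) * x j ≤ 0}`. -/
def homPolyhedron {d : ℕ} (rows : List (Fin (d + 1) → ℤ)) : Set (Fin d → ℝ) :=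
  {x | ∀ r ∈ rows, (r 0 : ℝ) + ∑ j, (r (Fin.succ j) : ℝ) * x j ≤ 0}

/-- The point with homogeneous coordinates `y`. -/
noncomputable def dehom {d : ℕ} (y : Fin (d + 1) → ℤ) : Fin d → ℝ :=
  fun j => (y j.succ : ℝ) / (y 0 : ℝ)

theorem dotProduct_eq_mul_dehom {d : ℕ} (r y : Fin (d + 1) → ℤ) (hy : y 0 ≠ 0) :
    ((r ⬝ᵥ y : ℤ) : ℝ) = y 0 * ((r 0 : ℝ) + ∑ j, (r (Fin.succ j) : ℝ) * dehom y j) := by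
  have hy' : (y 0 : ℝ) ≠ 0 := by exact_mod_cast hy
  simp only [dotProduct, Fin.sum_univ_succ, dehom]
  push_cast
  rw [mul_add, Finset.mul_sum, mul_comm]
  congr 1
  refine Finset.sum_congr rfl fun j _ => ?_
  field_simp

/-- The rows tight at an extreme point `x` have only the multiples of `(1, x)` as common orthogonal
vectors, so `d` of them have a nonzero multiple of `(1, x)` as cross product. -/
theorem mem_vertexList_of_mem_extremePoints {d : ℕ} {rows : List (Fin (d + 1) → ℤ)}
    {x : Fin d → ℝ} (hx : x ∈ Set.extremePoints ℝ (homPolyhedron rows)) :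
    ∃ y ∈ vertexList rows, dehom y = x := by
  set y₀ : Fin (d + 1) → ℝ := Fin.cons 1 x with hy₀
  have hdot : ∀ r w : Fin (d + 1) → ℝ, r ⬝ᵥ w = r 0 * w 0 + ∑ j : Fin d, r j.succ * w j.succ :=
    fun r w => by rw [dotProduct, Fin.sum_univ_succ]
  let s : Set (Fin (d + 1) → ℝ) :=
    {t | ∃ r ∈ rows, (r 0 : ℝ) + ∑ j, (r (Fin.succ j) : ℝ) * x j = 0 ∧ t = fun j => (r j : ℝ)}
  obtain ⟨t, ht, c, hc, htc⟩ := exists_cross_eq_smul s (y := y₀)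
    (fun h => by simpa [hy₀] using congrFun h 0)
    (by
      rintro _ ⟨r, -, hr, rfl⟩
      rw [hdot]
      simpa [hy₀] using hr)
    (by
      intro w hw
      -- Subtracting `w 0 • (1, x)` from `w` leaves a direction along which all tight constraints
      -- are constant.
      have hz : (fun j : Fin d => w j.succ - w 0 * x j) = 0 := by
        let a : {r // r ∈ rows} → (Fin d → ℝ) →ₗ[ℝ] ℝ := fun r =>
          dotProductEquiv ℝ (Fin d) fun j => (r.1 j.succ : ℝ)
        have ha : ∀ r v, a r v = ∑ j, (r.1 (Fin.succ j) : ℝ) * v j := fun r v => rfl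
        have hset : homPolyhedron rows = {x | ∀ r, a r x ≤ -(r.1 0 : ℝ)} := by
          ext v
          simp only [homPolyhedron, Set.mem_ofPred_eq, Subtype.forall, ha]
          refine forall₂_congr fun r _ => ?_
          constructor <;> intro h <;> linarith
        rw [hset] at hx
        refine eq_zero_of_mem_extremePoints hx fun r hr => ?_
        rw [ha] at hr ⊢
        have h1 := hw _ ⟨r.1, r.2, by linarith, rfl⟩
        rw [hdot] at h1
        have h2 : (r.1 0 : ℝ) = - ∑ j, (r.1 (Fin.succ j) : ℝ) * x j := by linarith
        simp only [mul_sub, Finset.sum_sub_distrib]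
        rw [h2] at h1
        have h3 : ∑ j, (r.1 (Fin.succ j) : ℝ) * (w 0 * x j) =
            w 0 * ∑ j, (r.1 (Fin.succ j) : ℝ) * x j := by
          rw [Finset.mul_sum]
          exact Finset.sum_congr rfl fun j _ => by ring
        rw [h3]
        linarith
      refine ⟨w 0, ?_⟩
      ext j
      cases j using Fin.cases with
      | zero => simp [hy₀]
      | succ j => simpa [hy₀, sub_eq_zero] using congrFun hz j)
  choose r hr htight htr using ht
  have hcast : ∀ j, ((cross r j : ℤ) : ℝ) = c * y₀ j := by
    intro j
    have h := cross_map (Int.castRingHom ℝ) r j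
    have h' : t = fun i l => (Int.castRingHom ℝ) (r i l) := by
      ext i l
      rw [htr i]
      rfl
    rw [← h', htc] at h
    exact h.symm
  have h0 : ((cross r 0 : ℤ) : ℝ) = c := by simpa [hy₀] using hcast 0
  have h0' : cross r 0 ≠ 0 := by
    intro h
    rw [h] at h0
    exact hc (by simpa using h0.symm)
  -- The sign of the cross product is unknown; multiplying by its first coordinate makes that
  -- coordinate a positive square.
  set y : Fin (d + 1) → ℤ := fun j => cross r 0 * cross r j with hy
  have hy0 : 0 < y 0 := mul_self_pos.2 h0'
  have hyx : dehom y = x := by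
    ext j
    simp only [dehom, hy, Int.cast_mul, hcast]
    simp only [hy₀, Fin.cons_zero, Fin.cons_succ]
    field_simp
  refine ⟨y, ?_, hyx⟩
  rw [vertexList, List.mem_filter]
  refine ⟨List.mem_map.2 ⟨r, mem_tuples.2 hr, rfl⟩, ?_⟩
  rw [decide_eq_true_eq]
  refine ⟨hy0, fun r' hr' => ?_⟩
  have h1 := dotProduct_eq_mul_dehom r' y hy0.ne'
  rw [hyx] at h1
  have h2 := hx.1 r' hr'
  have h3 : ((r' ⬝ᵥ y : ℤ) : ℝ) ≤ 0 := by
    rw [h1]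
    exact mul_nonpos_of_nonneg_of_nonpos (by exact_mod_cast hy0.le) h2
  exact_mod_cast h3

theorem homPolyhedron_eq_convexHull {d : ℕ} {rows : List (Fin (d + 1) → ℤ)}
    (hb : Bornology.IsBounded (homPolyhedron rows)) :
    homPolyhedron rows = convexHull ℝ (dehom '' {y | y ∈ vertexList rows}) := by
  have hset : homPolyhedron rows = ⋂ r ∈ rows,
      {x | (r 0 : ℝ) + ∑ j, (r (Fin.succ j) : ℝ) * x j ≤ 0} := by
    ext x
    simp [homPolyhedron]
  refine eq_convexHull_of_extremePoints_subset ?_ ?_ ?_ ?_ ?_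
  · refine Metric.isCompact_of_isClosed_isBounded ?_ hb
    rw [hset]
    exact isClosed_biInter fun r _ => isClosed_le (by fun_prop) continuous_const
  · rw [hset]
    refine convex_iInter₂ fun r _ => ?_
    have h : {x : Fin d → ℝ | (r 0 : ℝ) + ∑ j, (r (Fin.succ j) : ℝ) * x j ≤ 0} =
        {x | dotProductEquiv ℝ (Fin d) (fun j => (r j.succ : ℝ)) x ≤ -(r 0 : ℝ)} := by
      ext x
      change (r 0 : ℝ) + ∑ j, (r (Fin.succ j) : ℝ) * x j ≤ 0 ↔
        ∑ j, (r (Fin.succ j) : ℝ) * x j ≤ -(r 0 : ℝ)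
      constructor <;> intro h <;> linarith
    rw [h]
    exact convex_halfSpace_le (LinearMap.isLinear _) _
  · exact (List.finite_toSet _).image _
  · rintro _ ⟨y, hy, rfl⟩ r hr
    have hy' := (List.mem_filter.1 hy).2
    rw [decide_eq_true_eq] at hy'
    have h := dotProduct_eq_mul_dehom r y hy'.1.ne'
    have h2 : ((r ⬝ᵥ y : ℤ) : ℝ) ≤ 0 := by exact_mod_cast hy'.2 r hr
    rw [h] at h2
    exact nonpos_of_mul_nonpos_right h2 (by exact_mod_cast hy'.1)
  · intro x hx
    exact mem_vertexList_of_mem_extremePoints hx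

theorem clearDen_cast {k : ℕ} (q : Fin k → ℚ) (j : Fin k) :
    (clearDen q j : ℚ) = q j * ∏ i, ((q i).den : ℚ) := by
  rw [← Finset.mul_prod_erase _ _ (Finset.mem_univ j), ← mul_assoc, Rat.mul_den_eq_num, clearDen]
  push_cast
  rfl

theorem homRow_le_iff {d : ℕ} (a : Fin d → ℚ) (b : ℚ) (x : Fin d → ℝ) :
    (homRow (a, b) 0 : ℝ) + ∑ j, (homRow (a, b) (Fin.succ j) : ℝ) * x j ≤ 0 ↔
      ∑ j, (a j : ℝ) * x j ≤ b := by
  set q : Fin (d + 1) → ℚ := Fin.cons b a with hq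
  set N : ℚ := ∏ i, ((q i).den : ℚ) with hN
  have hNpos : (0 : ℝ) < N := by
    have : 0 < N := Finset.prod_pos fun i _ => by exact_mod_cast (q i).den_pos
    exact_mod_cast this
  have hcast : ∀ j, ((clearDen q j : ℤ) : ℝ) = (q j : ℝ) * N := fun j => by
    have := clearDen_cast q j
    rw [← hN] at this
    have h := congrArg (fun z : ℚ => (z : ℝ)) this
    simpa using h
  have h0 : (homRow (a, b) 0 : ℝ) = -(b * N) := by
    have : homRow (a, b) 0 = -clearDen q 0 := rfl
    rw [this, Int.cast_neg, hcast]
    rfl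
  have hj : ∀ j, (homRow (a, b) (Fin.succ j) : ℝ) = a j * N := fun j => by
    have : homRow (a, b) (Fin.succ j) = clearDen q j.succ := rfl
    rw [this, hcast]
    rfl
  simp only [h0, hj]
  have : ∑ j, (a j : ℝ) * N * x j = N * ∑ j, (a j : ℝ) * x j := by
    rw [Finset.mul_sum]
    exact Finset.sum_congr rfl fun j _ => by ring
  rw [this]
  constructor <;> intro h <;> nlinarith

/-! ## Correctness of the algorithm -/

/-- The point `u / Q`. -/
noncomputable def scaledPoint {d : ℕ} (Q : ℤ) (u : Fin d → ℤ) : Fin d → ℝ := fun j => (u j : ℝ) / Q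

theorem rescale_eq {d : ℕ} {W : List (List (Fin (d + 1) → ℤ))} {V : List (Fin (d + 1) → ℤ)}
    (hV : V ∈ W) {y : Fin (d + 1) → ℤ} (hy : y ∈ V) (hy0 : 0 < y 0)
    (hQ : 0 < (denominators W).prod) :
    scaledPoint (denominators W).prod (rescale (denominators W) y) = dehom y := by
  have hmem : y 0 ∈ denominators W :=
    List.mem_dedup.2 (List.mem_map.2 ⟨y, List.mem_flatten.2 ⟨V, hV, hy⟩, rfl⟩)
  have hnd : (denominators W).Nodup := List.nodup_dedup _
  -- The denominators are distinct, so filtering removes exactly one factor, and the remaining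
  -- product is `Q / y 0`.
  have hf : ((denominators W).filter fun z => decide (z ≠ y 0)) = (denominators W).erase (y 0) := by
    rw [hnd.erase_eq_filter]
    congr 1
    ext z
    by_cases hz : z = y 0 <;> simp [hz]
  have hprod := List.prod_erase hmem
  ext j
  have h1 : ((denominators W).prod : ℝ) = y 0 * ((denominators W).erase (y 0)).prod := by
    exact_mod_cast hprod.symm
  have h2 : (y 0 : ℝ) ≠ 0 := by exact_mod_cast hy0.ne'
  have h3 : ((denominators W).prod : ℝ) ≠ 0 := by exact_mod_cast hQ.ne'
  have h4 : (((denominators W).erase (y 0)).prod : ℝ) ≠ 0 := by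
    rw [h1] at h3
    exact right_ne_zero_of_mul h3
  simp only [scaledPoint, rescale, dehom]
  rw [hf, h1, Int.cast_mul]
  field_simp

theorem denominators_prod_pos {d : ℕ} {W : List (List (Fin (d + 1) → ℤ))}
    (hW : ∀ V ∈ W, ∀ y ∈ V, 0 < y 0) : 0 < (denominators W).prod := by
  refine List.prod_pos fun z hz => ?_
  obtain ⟨y, hy, rfl⟩ := List.mem_map.1 (List.mem_dedup.1 hz)
  obtain ⟨V, hV, hyV⟩ := List.mem_flatten.1 hy
  exact hW V hV y hyV

theorem sameDir_iff {k : ℕ} {c c' : Fin k → ℤ} (hc : c ≠ 0) :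
    SameDir c c' ↔ ∃ a : ℝ, 0 < a ∧ ∀ j, (c' j : ℝ) = a * c j := by
  have hA : 0 < c ⬝ᵥ c := by
    obtain ⟨j, hj⟩ := Function.ne_iff.1 hc
    exact Finset.sum_pos' (fun i _ => mul_self_nonneg _) ⟨j, Finset.mem_univ j, mul_self_pos.2 hj⟩
  constructor
  · rintro ⟨h, hpos⟩
    -- The squared norm of this vector is `c ⬝ᵥ c` times the defect in Cauchy–Schwarz.
    have hw : (c ⬝ᵥ c) • c' - (c ⬝ᵥ c') • c = 0 := by
      rw [← dotProduct_self_eq_zero]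
      simp only [sub_dotProduct, dotProduct_sub, smul_dotProduct, dotProduct_smul, smul_eq_mul,
        dotProduct_comm c' c]
      linear_combination (-(c ⬝ᵥ c)) * h
    have hA' : (0 : ℝ) < (c ⬝ᵥ c : ℤ) := by exact_mod_cast hA
    have hB' : (0 : ℝ) < (c ⬝ᵥ c' : ℤ) := by exact_mod_cast hpos
    refine ⟨(c ⬝ᵥ c' : ℤ) / (c ⬝ᵥ c : ℤ), div_pos hB' hA', fun j => ?_⟩
    have h1 := congrFun hw j
    simp only [Pi.sub_apply, Pi.smul_apply, smul_eq_mul, Pi.zero_apply, sub_eq_zero] at h1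
    have h2 : ((c ⬝ᵥ c : ℤ) : ℝ) * c' j = (c ⬝ᵥ c' : ℤ) * c j := by exact_mod_cast h1
    field_simp
    linarith
  · rintro ⟨a, ha, h⟩
    have hA' : (0 : ℝ) < (c ⬝ᵥ c : ℤ) := by exact_mod_cast hA
    have h1 : ((c ⬝ᵥ c' : ℤ) : ℝ) = a * (c ⬝ᵥ c : ℤ) := by
      simp only [dotProduct, Int.cast_sum, Int.cast_mul, h, Finset.mul_sum]
      exact Finset.sum_congr rfl fun j _ => by ring
    have h2 : ((c' ⬝ᵥ c' : ℤ) : ℝ) = a * a * (c ⬝ᵥ c : ℤ) := by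
      simp only [dotProduct, Int.cast_sum, Int.cast_mul, h, Finset.mul_sum]
      exact Finset.sum_congr rfl fun j _ => by ring
    constructor
    · have : ((c ⬝ᵥ c' : ℤ) : ℝ) * (c ⬝ᵥ c' : ℤ) = (c ⬝ᵥ c : ℤ) * (c' ⬝ᵥ c' : ℤ) := by
        rw [h1, h2]
        ring
      exact_mod_cast this
    · have : (0 : ℝ) < (c ⬝ᵥ c' : ℤ) := by
        rw [h1]
        positivity
      exact_mod_cast this

theorem SameDir.left_ne_zero {k : ℕ} {c c' : Fin k → ℤ} (h : SameDir c c') : c ≠ 0 := by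
  rintro rfl
  simpa using h.2

theorem SameDir.trans {k : ℕ} {c c' c'' : Fin k → ℤ} (h : SameDir c c') (h' : SameDir c' c'') :
    SameDir c c'' := by
  obtain ⟨a, ha, hac⟩ := (sameDir_iff h.left_ne_zero).1 h
  obtain ⟨b, hb, hbc⟩ := (sameDir_iff h'.left_ne_zero).1 h'
  exact (sameDir_iff h.left_ne_zero).2 ⟨b * a, mul_pos hb ha, fun j => by rw [hbc, hac, mul_assoc]⟩

theorem exists_sameDir_mem_pwFilter {k : ℕ} {l : List (Fin k → ℤ)} {c : Fin k → ℤ} (hc : c ∈ l)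
    (hc0 : c ≠ 0) : ∃ c' ∈ l.pwFilter (fun c c' => ¬SameDir c c'), SameDir c c' := by
  by_contra! h
  have := (List.forall_mem_pwFilter (R := fun c c' : Fin k → ℤ => ¬SameDir c c')
    -- Contrapositive of transitivity: it ensures that each discarded vector has a representative
    -- among the kept ones.
    (fun {x y z} hxz => by
      by_contra! hxy
      exact hxz (hxy.1.trans hxy.2)) c l).1 h c hc
  exact this ((sameDir_iff hc0).2 ⟨1, one_pos, fun j => by simp⟩)

theorem dotProduct_le_support {k : ℕ} (c : Fin k → ℤ) {V : List (Fin k → ℤ)} {u : Fin k → ℤ}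
    (hu : u ∈ V) : c ⬝ᵥ u ≤ support c V :=
  le_listMax (List.mem_map.2 ⟨u, hu, rfl⟩)

theorem exists_dotProduct_eq_support {k : ℕ} (c : Fin k → ℤ) {V : List (Fin k → ℤ)}
    (hV : V ≠ []) : ∃ u ∈ V, c ⬝ᵥ u = support c V :=
  List.mem_map.1 (listMax_mem (by simpa using hV))

section Functionals

variable {d n : ℕ}

/-- The linear functional `(x, z) ↦ α ⬝ᵥ x + ν ⬝ᵥ z`. -/
noncomputable def functional (α : Fin d → ℝ) (ν : Fin n → ℝ) :
    (Fin d → ℝ) × (Fin n → ℝ) →ₗ[ℝ] ℝ :=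
  (dotProductEquiv ℝ (Fin d) α).coprod (dotProductEquiv ℝ (Fin n) ν)

theorem functional_surjective (f : (Fin d → ℝ) × (Fin n → ℝ) →ₗ[ℝ] ℝ) :
    ∃ α ν, f = functional α ν := by
  obtain ⟨α, hα⟩ := (dotProductEquiv ℝ (Fin d)).surjective (f ∘ₗ LinearMap.inl ℝ _ _)
  obtain ⟨ν, hν⟩ := (dotProductEquiv ℝ (Fin n)).surjective (f ∘ₗ LinearMap.inr ℝ _ _)
  refine ⟨α, ν, ?_⟩
  rw [functional, hα, hν]
  ext <;> simp

theorem functional_inj {α α' : Fin d → ℝ} {ν ν' : Fin n → ℝ} :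
    functional α ν = functional α' ν' ↔ α = α' ∧ ν = ν' := by
  refine ⟨fun h => ?_, fun h => by rw [h.1, h.2]⟩
  constructor
  · refine (dotProductEquiv ℝ (Fin d)).injective (LinearMap.ext fun x => ?_)
    simpa [functional] using LinearMap.congr_fun h (x, 0)
  · refine (dotProductEquiv ℝ (Fin n)).injective (LinearMap.ext fun x => ?_)
    simpa [functional] using LinearMap.congr_fun h (0, x)

theorem functional_smul (c : ℝ) (α : Fin d → ℝ) (ν : Fin n → ℝ) :
    c • functional α ν = functional (c • α) (c • ν) := by
  ext <;> simp [functional]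

theorem functional_zero : functional (0 : Fin d → ℝ) (0 : Fin n → ℝ) = 0 := by
  ext <;> simp [functional]

/-- Extending `ν` by `0` at index `0` treats the layer over the origin like all others. -/
theorem functional_unitVec (α : Fin d → ℝ) (ν : Fin n → ℝ) (x : Fin d → ℝ) (i : Fin (n + 1)) :
    functional α ν (x, unitVec n i) = α ⬝ᵥ x + (Fin.cons 0 ν : Fin (n + 1) → ℝ) i := by
  cases i using Fin.cases <;> simp [functional, unitVec]

theorem lhs_eq_functional (r : Ineq d n) :
    r.lhs = functional (fun j => (r.α j : ℝ)) (fun i => (r.μ i : ℝ)) := by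
  refine LinearMap.ext fun p => ?_
  simp [Ineq.lhs, functional, dotProduct]

theorem eq_of_cons_zero_eq {ν ν' : Fin n → ℝ}
    (h : ∀ i, (Fin.cons 0 ν : Fin (n + 1) → ℝ) i = (Fin.cons 0 ν' : Fin (n + 1) → ℝ) i) :
    ν = ν' :=
  funext fun i => by simpa using h i.succ

end Functionals

/-! ### Facet inequalities of the hull of the lifted points -/

/-- The lifted points `(u / Q, e i)`, `u ∈ V i`. -/
def liftedPoints {d n : ℕ} (Q : ℤ) (V : Fin (n + 1) → List (Fin d → ℤ)) :
    Set ((Fin d → ℝ) × (Fin n → ℝ)) :=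
  ⋃ i, (fun u => (scaledPoint Q u, unitVec n i)) '' {u | u ∈ V i}

/-- The inequality `0 ≤ z k` for `i = k + 1`, and `∑ k, z k ≤ 1` for `i = 0`. -/
def simplexIneq (d : ℕ) {n : ℕ} (i : Fin (n + 1)) : Ineq d n where
  α := 0
  μ k := Fin.cases 1 (fun l => if l = k then -1 else 0) i
  ρ := if i = 0 then 1 else 0

/-- The inequality with normal vector `c` that is tight for all lists `V i`. -/
def normalIneq {d n : ℕ} (Q : ℤ) (V : Fin (n + 1) → List (Fin d → ℤ)) (c : Fin d → ℤ) :
    Ineq d n where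
  α := fun j => Q * c j
  μ k := support c (V 0) - support c (V k.succ)
  ρ := support c (V 0)

section

variable {d n : ℕ} {Q : ℤ} {V : Fin (n + 1) → List (Fin d → ℤ)}

theorem forall_mem_liftedPoints {p : (Fin d → ℝ) × (Fin n → ℝ) → Prop} :
    (∀ x ∈ liftedPoints Q V, p x) ↔ ∀ i, ∀ u ∈ V i, p (scaledPoint Q u, unitVec n i) := by
  simp only [liftedPoints, Set.mem_iUnion, Set.mem_image, Set.mem_ofPred_eq]
  constructor
  · intro h i u hu
    exact h _ ⟨i, u, hu, rfl⟩
  · rintro h _ ⟨i, u, hu, rfl⟩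
    exact h i u hu

theorem mem_liftedPoints {i : Fin (n + 1)} {u : Fin d → ℤ} (hu : u ∈ V i) :
    (scaledPoint Q u, unitVec n i) ∈ liftedPoints Q V :=
  forall_mem_liftedPoints.1 (fun _ h => h) i u hu

theorem finite_liftedPoints : (liftedPoints Q V).Finite :=
  Set.finite_iUnion fun i => (List.finite_toSet (V i)).image _

/-- The slack is the `i`-th barycentric coordinate with respect to `e 0, …, e n`. -/
theorem simplexIneq_apply (x : Fin d → ℝ) (i j : Fin (n + 1)) :
    (simplexIneq d i).lhs (x, unitVec n j) =
      (simplexIneq (n := n) d i).ρ - if j = i then 1 else 0 := by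
  rw [lhs_eq_functional, functional_unitVec]
  cases i using Fin.cases with
  | zero =>
    cases j using Fin.cases <;> simp [simplexIneq, dotProduct]
  | succ i =>
    cases j using Fin.cases with
    | zero => simp [simplexIneq, dotProduct, (Fin.succ_ne_zero i).symm]
    | succ j =>
      by_cases h : i = j
      · simp [simplexIneq, dotProduct, h]
      · simp [simplexIneq, dotProduct, h, Ne.symm h]

theorem dotProduct_scaledPoint (Q : ℤ) (c u : Fin d → ℤ) :
    (fun j => (c j : ℝ)) ⬝ᵥ scaledPoint Q u = ((c ⬝ᵥ u : ℤ) : ℝ) / Q := by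
  simp only [dotProduct, scaledPoint, Int.cast_sum, Int.cast_mul, Finset.sum_div, mul_div_assoc]

/-- The factor `Q` in the normal cancels the denominator of the scaled point, so a point is tight
exactly when it maximizes `c` in its layer. -/
theorem normalIneq_apply (hQ : 0 < Q) (c u : Fin d → ℤ) (i : Fin (n + 1)) :
    (normalIneq Q V c).lhs (scaledPoint Q u, unitVec n i) =
      (normalIneq Q V c).ρ - (((support c (V i) - c ⬝ᵥ u : ℤ)) : ℝ) := by
  have hQ' : (Q : ℝ) ≠ 0 := by exact_mod_cast hQ.ne'
  rw [lhs_eq_functional, functional_unitVec]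
  have h : (fun j => (((normalIneq Q V c).α j : ℤ) : ℝ)) = (Q : ℝ) • fun j => (c j : ℝ) := by
    ext j
    simp [normalIneq]
  rw [h, smul_dotProduct, dotProduct_scaledPoint, smul_eq_mul, mul_div_cancel₀ _ hQ']
  cases i using Fin.cases with
  | zero => simp [normalIneq]
  | succ i => simp [normalIneq]; ring

variable (hne : ∀ i, V i ≠ [])
  (hfull : ∀ i (w : Fin d → ℝ) (γ : ℝ), (∀ u ∈ V i, w ⬝ᵥ scaledPoint Q u = γ) → w = 0)

include hne in
theorem liftedPoints_nonempty : (convexHull ℝ (liftedPoints Q V)).Nonempty := by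
  obtain ⟨u, hu⟩ := List.exists_mem_of_ne_nil _ (hne 0)
  exact ⟨_, subset_convexHull ℝ _ (mem_liftedPoints hu)⟩

include hne hfull in
-- If a functional is constant on all layers, full-dimensionality of layer `0` kills its `x`-part;
-- the `z`-part then has the same value on all `e i`, which is `0` because of `e 0`.
theorem polyDim_liftedPoints : polyDim (convexHull ℝ (liftedPoints Q V)) =
    Module.finrank ℝ ((Fin d → ℝ) × (Fin n → ℝ)) := by
  refine (polyDim_eq_finrank_iff (liftedPoints_nonempty hne)).2 fun g γ hg => ?_
  obtain ⟨α, ν, rfl⟩ := functional_surjective g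
  have h : ∀ i, ∀ u ∈ V i, α ⬝ᵥ scaledPoint Q u + (Fin.cons 0 ν : Fin (n + 1) → ℝ) i = γ := by
    intro i u hu
    rw [← functional_unitVec]
    exact hg _ (subset_convexHull ℝ _ (mem_liftedPoints hu))
  have hα : α = 0 := hfull 0 α γ fun u hu => by simpa using h 0 u hu
  subst hα
  have hν : ∀ i, (Fin.cons 0 ν : Fin (n + 1) → ℝ) i = γ := by
    intro i
    obtain ⟨u, hu⟩ := List.exists_mem_of_ne_nil _ (hne i)
    simpa using h i u hu
  have hγ : γ = 0 := by simpa using (hν 0).symm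
  have : ν = 0 := eq_of_cons_zero_eq fun i => by
    rw [hν, hγ]
    cases i using Fin.cases <;> simp
  rw [this, functional_zero]

theorem one_le_finrank (hn : 1 ≤ n) : 1 ≤ Module.finrank ℝ ((Fin d → ℝ) × (Fin n → ℝ)) := by
  simp
  omega

theorem simplexIneq_ne_zero (i : Fin (n + 1)) (hn : 1 ≤ n) : (simplexIneq d i).lhs ≠ 0 := by
  have : Nontrivial (Fin (n + 1)) := Fin.nontrivial_iff_two_le.2 (by omega)
  obtain ⟨j, hj⟩ := exists_ne i
  intro h
  have h1 := simplexIneq_apply (0 : Fin d → ℝ) i i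
  have h2 := simplexIneq_apply (0 : Fin d → ℝ) i j
  rw [h] at h1 h2
  simp only [LinearMap.zero_apply, if_neg hj, if_true] at h1 h2
  linarith

theorem valid_simplexIneq (i : Fin (n + 1)) :
    Valid (convexHull ℝ (liftedPoints Q V)) (simplexIneq d i).lhs (simplexIneq (n := n) d i).ρ := by
  refine valid_convexHull (forall_mem_liftedPoints.2 fun j u hu => ?_)
  rw [simplexIneq_apply]
  split_ifs <;> simp

include hne hfull in
theorem describesFacet_simplexIneq (hn : 1 ≤ n) (i : Fin (n + 1)) :
    DescribesFacet (convexHull ℝ (liftedPoints Q V)) (simplexIneq d i).lhs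
      (simplexIneq (n := n) d i).ρ := by
  have htight : ∀ j, j ≠ i → ∀ u ∈ V j, (scaledPoint Q u, unitVec n j) ∈
      face (convexHull ℝ (liftedPoints Q V)) (simplexIneq d i).lhs (simplexIneq (n := n) d i).ρ :=
    fun j hj u hu => ⟨subset_convexHull ℝ _ (mem_liftedPoints hu), by
      rw [simplexIneq_apply, if_neg hj, sub_zero]⟩
  have : Nontrivial (Fin (n + 1)) := Fin.nontrivial_iff_two_le.2 (by omega)
  obtain ⟨j, hj⟩ := exists_ne i
  obtain ⟨u, hu⟩ := List.exists_mem_of_ne_nil _ (hne j)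
  refine (describesFacet_iff (polyDim_liftedPoints hne hfull) (one_le_finrank hn)).2
    ⟨valid_simplexIneq i, simplexIneq_ne_zero i hn, ⟨_, htight j hj u hu⟩, fun g γ hg => ?_⟩
  obtain ⟨α, ν, rfl⟩ := functional_surjective g
  have h : ∀ l, l ≠ i → ∀ u ∈ V l,
      α ⬝ᵥ scaledPoint Q u + (Fin.cons 0 ν : Fin (n + 1) → ℝ) l = γ := by
    intro l hl u hu
    rw [← functional_unitVec]
    exact hg _ (htight l hl u hu)
  have hα : α = 0 := hfull j α (γ - (Fin.cons 0 ν : Fin (n + 1) → ℝ) j) fun u hu => by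
    rw [← h j hj u hu]
    ring
  subst hα
  set ν' : Fin (n + 1) → ℝ := Fin.cons 0 ν with hν'
  -- All layers but `i` take the value `γ`, so the functional is determined by its defect `c` at `e
  -- i`; the value `0` at `e 0` then fixes `γ`.
  set c := γ - ν' i with hc
  have hν : ∀ l, ν' l = γ - c * if l = i then 1 else 0 := by
    intro l
    split_ifs with hl
    · rw [hl, hc]; ring
    · obtain ⟨u, hu⟩ := List.exists_mem_of_ne_nil _ (hne l)
      simpa using h l hl u hu
  have h0 : γ = c * if 0 = i then 1 else 0 := by
    have := hν 0
    rw [hν', Fin.cons_zero] at this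
    linarith
  refine ⟨c, ?_⟩
  rw [lhs_eq_functional, functional_smul, functional_inj]
  constructor
  · ext j
    simp [simplexIneq]
  · refine eq_of_cons_zero_eq fun l => ?_
    have h1 := simplexIneq_apply (0 : Fin d → ℝ) i l
    have h2 := simplexIneq_apply (0 : Fin d → ℝ) i 0
    rw [lhs_eq_functional, functional_unitVec, dotProduct_zero, zero_add] at h1 h2
    rw [Fin.cons_zero] at h2
    change ν' l = _
    rw [hν, h0]
    cases l using Fin.cases with
    | zero => simp
    | succ l =>
      rw [Fin.cons_succ] at h1
      rw [Fin.cons_succ, Pi.smul_apply, smul_eq_mul, h1]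
      linear_combination c * h2

variable (hQ : 0 < Q)

include hQ in
theorem valid_normalIneq (c : Fin d → ℤ) :
    Valid (convexHull ℝ (liftedPoints Q V)) (normalIneq Q V c).lhs (normalIneq Q V c).ρ := by
  refine valid_convexHull (forall_mem_liftedPoints.2 fun i u hu => ?_)
  rw [normalIneq_apply hQ]
  have : (0 : ℝ) ≤ ((support c (V i) - c ⬝ᵥ u : ℤ) : ℝ) := by
    exact_mod_cast sub_nonneg.2 (dotProduct_le_support c hu)
  linarith

include hQ in
theorem normalIneq_ne_zero {c : Fin d → ℤ} (hc : c ≠ 0) : (normalIneq Q V c).lhs ≠ 0 := by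
  intro h
  rw [lhs_eq_functional, ← functional_zero, functional_inj] at h
  refine hc (funext fun j => ?_)
  have := congrFun h.1 j
  simpa [normalIneq, hQ.ne'] using this

include hne hfull hQ in
/-- If the maximizers of `c` in the lists `V i` span a hyperplane, then `c` is the normal vector of
a facet. -/
theorem describesFacet_normalIneq (hn : 1 ≤ n) {c : Fin d → ℤ} (hc : c ≠ 0)
    (hspan : ∀ w : Fin d → ℝ, (∀ i, ∀ u ∈ V i, ∀ u' ∈ V i, c ⬝ᵥ u = support c (V i) →
      c ⬝ᵥ u' = support c (V i) → w ⬝ᵥ scaledPoint Q u = w ⬝ᵥ scaledPoint Q u') →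
      ∃ a : ℝ, w = a • fun j => (c j : ℝ)) :
    DescribesFacet (convexHull ℝ (liftedPoints Q V)) (normalIneq Q V c).lhs
      (normalIneq Q V c).ρ := by
  have hQ' : (Q : ℝ) ≠ 0 := by exact_mod_cast hQ.ne'
  have htight : ∀ i, ∀ u ∈ V i, c ⬝ᵥ u = support c (V i) → (scaledPoint Q u, unitVec n i) ∈
      face (convexHull ℝ (liftedPoints Q V)) (normalIneq Q V c).lhs (normalIneq Q V c).ρ :=
    fun i u hu h => ⟨subset_convexHull ℝ _ (mem_liftedPoints hu), by
      rw [normalIneq_apply hQ, h]; simp⟩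
  obtain ⟨u₀, hu₀, h₀⟩ := exists_dotProduct_eq_support c (hne 0)
  refine (describesFacet_iff (polyDim_liftedPoints hne hfull) (one_le_finrank hn)).2
    ⟨valid_normalIneq hQ c, normalIneq_ne_zero hQ hc, ⟨_, htight 0 u₀ hu₀ h₀⟩, fun g γ hg => ?_⟩
  obtain ⟨α, ν, rfl⟩ := functional_surjective g
  have h : ∀ i, ∀ u ∈ V i, c ⬝ᵥ u = support c (V i) →
      α ⬝ᵥ scaledPoint Q u + (Fin.cons 0 ν : Fin (n + 1) → ℝ) i = γ := by
    intro i u hu hs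
    rw [← functional_unitVec]
    exact hg _ (htight i u hu hs)
  obtain ⟨a, rfl⟩ := hspan α fun i u hu u' hu' hs hs' => by
    linarith [h i u hu hs, h i u' hu' hs']
  -- Every layer has a maximizer of `c`, so the `x`-part determines the `z`-part up to `γ`, and
  -- layer `0` determines `γ`.
  have hν : ∀ i, (Fin.cons 0 ν : Fin (n + 1) → ℝ) i = γ - a * (support c (V i) / Q) := by
    intro i
    obtain ⟨u, hu, hs⟩ := exists_dotProduct_eq_support c (hne i)
    have := h i u hu hs
    rw [smul_dotProduct, dotProduct_scaledPoint, hs, smul_eq_mul] at this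
    linarith
  have hγ : γ = a * (support c (V 0) / Q) := by
    have := hν 0
    rw [Fin.cons_zero] at this
    linarith
  refine ⟨a / Q, ?_⟩
  rw [lhs_eq_functional, functional_smul, functional_inj]
  constructor
  · ext j
    simp only [normalIneq, Pi.smul_apply, smul_eq_mul, Int.cast_mul]
    field_simp
  · ext k
    have := hν k.succ
    rw [Fin.cons_succ] at this
    simp only [normalIneq, Pi.smul_apply, smul_eq_mul, Int.cast_sub]
    rw [this, hγ]
    field_simp

end

/-! ### Candidate normals and completeness of the system -/

theorem mem_normals {e : ℕ} {U : List (List (Fin (e + 1) → ℤ))} {c : Fin (e + 1) → ℤ} :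
    c ∈ normals U ↔ ∃ t : Fin e → List (Fin (e + 1) → ℤ) × (Fin (e + 1) → ℤ) × (Fin (e + 1) → ℤ),
      (∀ j, (t j).1 ∈ U ∧ (t j).2.1 ∈ (t j).1 ∧ (t j).2.2 ∈ (t j).1) ∧
      ((c = cross fun j => (t j).2.1 - (t j).2.2) ∨ c = -cross fun j => (t j).2.1 - (t j).2.2) ∧
      c ≠ 0 ∧ ∀ j, ∀ w ∈ (t j).1, c ⬝ᵥ w ≤ c ⬝ᵥ (t j).2.1 := by
  have hpair : ∀ x : List (Fin (e + 1) → ℤ) × (Fin (e + 1) → ℤ) × (Fin (e + 1) → ℤ),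
      x ∈ pointPairs U ↔ x.1 ∈ U ∧ x.2.1 ∈ x.1 ∧ x.2.2 ∈ x.1 := by
    rintro ⟨V, u, u'⟩
    simp only [pointPairs, List.mem_flatMap, List.mem_map, Prod.mk.injEq]
    constructor
    · rintro ⟨V, hV, u, hu, u', hu', rfl, rfl, rfl⟩
      exact ⟨hV, hu, hu'⟩
    · rintro ⟨hV, hu, hu'⟩
      exact ⟨V, hV, u, hu, u', hu', rfl, rfl, rfl⟩
  simp only [normals, List.mem_map, List.mem_filter, List.mem_flatMap, mem_tuples, hpair,
    decide_eq_true_eq, List.mem_cons, List.not_mem_nil, or_false]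
  constructor
  · rintro ⟨⟨t, c⟩, ⟨⟨t', ht', h⟩, h0, hmax⟩, rfl⟩
    simp only [Prod.mk.injEq] at h
    have hne : c ≠ 0 := fun hc => h0 fun j => congrFun hc j
    rcases h with ⟨rfl, h⟩ | ⟨rfl, h⟩
    · exact ⟨t, ht', Or.inl h, hne, hmax⟩
    · exact ⟨t, ht', Or.inr h, hne, hmax⟩
  · rintro ⟨t, ht, h, h0, hmax⟩
    refine ⟨(t, c), ⟨⟨t, ht, ?_⟩, fun hc => h0 (funext hc), hmax⟩, rfl⟩
    rcases h with h | h
    · exact Or.inl (by rw [h])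
    · exact Or.inr (by rw [h])

/-- The inequality system computed from the scaled vertex lists. -/
def facetSystem {e n : ℕ} (Q : ℤ) (V : Fin (n + 1) → List (Fin (e + 1) → ℤ)) :
    List (Ineq (e + 1) n) :=
  List.ofFn (simplexIneq (e + 1)) ++
    ((normals (List.ofFn V)).pwFilter fun c c' => ¬SameDir c c').map (normalIneq Q V)

section

variable {e n : ℕ} {Q : ℤ} {V : Fin (n + 1) → List (Fin (e + 1) → ℤ)}

theorem dotProduct_scaledPoint_sub (hQ : 0 < Q) (w : Fin (e + 1) → ℝ) (u u' : Fin (e + 1) → ℤ) :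
    w ⬝ᵥ scaledPoint Q u = w ⬝ᵥ scaledPoint Q u' ↔
      (fun l => (((u - u') l : ℤ) : ℝ)) ⬝ᵥ w = 0 := by
  have hQ' : (Q : ℝ) ≠ 0 := by exact_mod_cast hQ.ne'
  have h : ∀ u : Fin (e + 1) → ℤ, scaledPoint Q u = (Q : ℝ)⁻¹ • fun l => (u l : ℝ) := by
    intro u
    ext l
    simp only [scaledPoint, Pi.smul_apply, smul_eq_mul]
    field_simp
  have h' : (fun l => (((u - u') l : ℤ) : ℝ)) = (fun l => (u l : ℝ)) - fun l => (u' l : ℝ) := by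
    ext l
    simp
  rw [h, h, dotProduct_smul, dotProduct_smul, h', sub_dotProduct, dotProduct_comm w,
    dotProduct_comm w, sub_eq_zero, smul_right_inj (inv_ne_zero hQ')]

/-- A functional that is constant on the maximizers within each layer is orthogonal to the chosen
differences, hence a multiple of their cross product `± c`. -/
theorem describesFacet_of_mem_normals (hne : ∀ i, V i ≠ [])
    (hfull : ∀ i (w : Fin (e + 1) → ℝ) (γ : ℝ), (∀ u ∈ V i, w ⬝ᵥ scaledPoint Q u = γ) → w = 0)
    (hQ : 0 < Q) (hn : 1 ≤ n) {c : Fin (e + 1) → ℤ} (hc : c ∈ normals (List.ofFn V)) :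
    DescribesFacet (convexHull ℝ (liftedPoints Q V)) (normalIneq Q V c).lhs
      (normalIneq Q V c).ρ := by
  obtain ⟨t, ht, htc, hc0, hmax⟩ := mem_normals.1 hc
  refine describesFacet_normalIneq hne hfull hQ hn hc0 fun w hw => ?_
  set T : Fin e → Fin (e + 1) → ℤ := fun j => (t j).2.1 - (t j).2.2 with hT
  have hcross : ∀ l, cross (fun j l => (T j l : ℝ)) l = ((cross T l : ℤ) : ℝ) :=
    cross_map (Int.castRingHom ℝ) T
  have horth : ∀ j, c ⬝ᵥ T j = 0 := by
    intro j
    have := dotProduct_cross_self T j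
    rw [dotProduct_comm] at this
    rcases htc with h | h <;> simp [h, this]
  have h0 : cross (fun j l => (T j l : ℝ)) ≠ 0 := by
    intro h
    refine hc0 ?_
    have h1 : cross T = 0 := funext fun l => by
      have := congrFun h l
      rw [hcross] at this
      simpa using this
    rcases htc with h | h <;> simp [h, h1]
  obtain ⟨a, ha⟩ := eq_smul_cross h0 (w := w) fun j => by
    rw [← dotProduct_scaledPoint_sub hQ]
    obtain ⟨hU, hu, hu'⟩ := ht j
    obtain ⟨i, hi⟩ := List.mem_ofFn.1 hU
    have h1 : c ⬝ᵥ (t j).2.1 = support c (V i) := by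
      refine le_antisymm (dotProduct_le_support c (hi ▸ hu)) ?_
      obtain ⟨v, hv, hv'⟩ := exists_dotProduct_eq_support c (hne i)
      rw [← hv']
      exact hmax j v (hi ▸ hv)
    -- The algorithm tests only the first point of each pair; orthogonality carries maximality over
    -- to the second.
    have h2 : c ⬝ᵥ (t j).2.2 = support c (V i) := by
      have := horth j
      rw [hT, dotProduct_sub] at this
      linarith
    exact hw i _ (hi ▸ hu) _ (hi ▸ hu') h1 h2
  rcases htc with h | h
  · refine ⟨a, ?_⟩
    rw [ha]
    ext l
    simp [hcross, h]
  · refine ⟨-a, ?_⟩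
    rw [ha]
    ext l
    simp [hcross, h]

/-- Every inequality describing a facet is up to a positive factor one of the computed system. -/
theorem exists_mem_facetSystem (hne : ∀ i, V i ≠ [])
    (hfull : ∀ i (w : Fin (e + 1) → ℝ) (γ : ℝ), (∀ u ∈ V i, w ⬝ᵥ scaledPoint Q u = γ) → w = 0)
    (hQ : 0 < Q) (hn : 1 ≤ n) {f : (Fin (e + 1) → ℝ) × (Fin n → ℝ) →ₗ[ℝ] ℝ} {β : ℝ}
    (hf : DescribesFacet (convexHull ℝ (liftedPoints Q V)) f β) :
    ∃ r ∈ facetSystem Q V, ∃ a : ℝ, 0 < a ∧ r.lhs = a • f ∧ (r.ρ : ℝ) = a * β := by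
  have hdim := polyDim_liftedPoints hne hfull
  have hE := one_le_finrank (d := e + 1) hn
  obtain ⟨hv, hf0, -, hmul⟩ := (describesFacet_iff hdim hE).1 hf
  obtain ⟨α, ν, rfl⟩ := functional_surjective f
  have hvG : ∀ x ∈ liftedPoints Q V, functional α ν x ≤ β :=
    fun x hx => hv x (subset_convexHull ℝ _ hx)
  have hface : ∀ (g : (Fin (e + 1) → ℝ) × (Fin n → ℝ) →ₗ[ℝ] ℝ) (γ : ℝ), (∀ i, ∀ u ∈ V i,
      functional α ν (scaledPoint Q u, unitVec n i) = β →
        g (scaledPoint Q u, unitVec n i) = γ) →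
      ∀ x ∈ face (convexHull ℝ (liftedPoints Q V)) (functional α ν) β, g x = γ := by
    intro g γ hg x hx
    refine eq_on_convexHull ?_ x (face_convexHull_subset hvG hx)
    rintro y ⟨hy, hy'⟩
    revert y
    exact forall_mem_liftedPoints.2 hg
  -- Either the facet misses a layer and is given by a simplex inequality, or it meets all of them
  -- and is given by a normal.
  by_cases hcase : ∃ i, ∀ u ∈ V i, functional α ν (scaledPoint Q u, unitVec n i) ≠ β
  · obtain ⟨i, hi⟩ := hcase
    refine ⟨simplexIneq (e + 1) i, List.mem_append_left _ (List.mem_ofFn.2 ⟨i, rfl⟩), ?_⟩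
    refine hf.exists_pos_smul hdim hE (valid_simplexIneq i) (simplexIneq_ne_zero i hn)
      (hface _ _ fun j u hu htight => ?_)
    rw [simplexIneq_apply, if_neg, sub_zero]
    rintro rfl
    exact hi u hu htight
  · push Not at hcase
    choose u₀ hu₀ htight₀ using hcase
    simp only [functional_unitVec] at htight₀ hface
    have hle : ∀ i, ∀ u ∈ V i, α ⬝ᵥ scaledPoint Q u ≤ α ⬝ᵥ scaledPoint Q (u₀ i) := by
      intro i u hu
      have h1 := hvG _ (mem_liftedPoints hu)
      rw [functional_unitVec, ← htight₀ i] at h1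
      linarith
    have htight : ∀ i, ∀ u ∈ V i, α ⬝ᵥ scaledPoint Q u + (Fin.cons 0 ν : Fin (n + 1) → ℝ) i = β ↔
        α ⬝ᵥ scaledPoint Q u = α ⬝ᵥ scaledPoint Q (u₀ i) := by
      intro i u hu
      rw [← htight₀ i]
      exact add_left_inj _
    let s : Set (Fin (e + 1) → ℝ) := {v | ∃ i, ∃ u ∈ V i, ∃ u' ∈ V i,
      α ⬝ᵥ scaledPoint Q u = α ⬝ᵥ scaledPoint Q (u₀ i) ∧
      α ⬝ᵥ scaledPoint Q u' = α ⬝ᵥ scaledPoint Q (u₀ i) ∧ v = fun l => (((u - u') l : ℤ) : ℝ)}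
    have hα : α ≠ 0 := by
      rintro rfl
      have hν : ∀ i, (Fin.cons 0 ν : Fin (n + 1) → ℝ) i = β := fun i => by
        simpa using htight₀ i
      have hβ : β = 0 := by simpa using (hν 0).symm
      refine hf0 ?_
      rw [← functional_zero, functional_inj]
      refine ⟨rfl, eq_of_cons_zero_eq fun i => ?_⟩
      rw [hν, hβ]
      cases i using Fin.cases <;> simp
    obtain ⟨t, ht, a, ha, hta⟩ := exists_cross_eq_smul s hα
      (by
        rintro _ ⟨i, u, -, u', -, h, h', rfl⟩
        rw [← dotProduct_scaledPoint_sub hQ, h, h'])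
      (by
        intro w hw
        -- The vector `w` is constant on the tight points of each layer. Choosing the `z`-part to
        -- level these constants gives a functional constant on the facet, hence a multiple of
        -- `functional α ν`.
        obtain ⟨b, hb⟩ := hmul (functional w fun k => w ⬝ᵥ scaledPoint Q (u₀ 0) -
          w ⬝ᵥ scaledPoint Q (u₀ k.succ)) (w ⬝ᵥ scaledPoint Q (u₀ 0)) (hface _ _ (by
          intro i u hu h
          have h1 := (dotProduct_scaledPoint_sub hQ w u (u₀ i)).2
            (hw _ ⟨i, u, hu, u₀ i, hu₀ i, (htight i u hu).1 h, rfl, rfl⟩)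
          rw [functional_unitVec, h1]
          cases i using Fin.cases <;> simp))
        rw [functional_smul, functional_inj] at hb
        exact ⟨b, hb.1⟩)
    choose i u hu u' hu' h h' htu using ht
    set T : Fin e → Fin (e + 1) → ℤ := fun j => u j - u' j with hT
    have hcross : ∀ l, ((cross T l : ℤ) : ℝ) = a * α l := by
      intro l
      have h1 : cross (fun j l => (T j l : ℝ)) l = ((cross T l : ℤ) : ℝ) :=
        cross_map (Int.castRingHom ℝ) T l
      have h2 : t = fun j l => (T j l : ℝ) := funext fun j => htu j
      rw [← h1, ← h2, hta]
      rfl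
    -- The cross product may point opposite to `α`; for this reason both signs are among the
    -- candidates.
    obtain ⟨c, κ, hκ, hcT, hcκ⟩ : ∃ (c : Fin (e + 1) → ℤ) (κ : ℝ), 0 < κ ∧
        (c = cross T ∨ c = -cross T) ∧ (fun l => (c l : ℝ)) = κ • α := by
      rcases ha.lt_or_gt with ha | ha
      · exact ⟨-cross T, -a, neg_pos.2 ha, Or.inr rfl, by ext l; simp [hcross]⟩
      · exact ⟨cross T, a, ha, Or.inl rfl, by ext l; simp [hcross]⟩
    have hQ' : (0 : ℝ) < Q := by exact_mod_cast hQ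
    have hdot : ∀ (c : Fin (e + 1) → ℤ) (κ : ℝ), (fun l => (c l : ℝ)) = κ • α →
        ∀ v : Fin (e + 1) → ℤ, ((c ⬝ᵥ v : ℤ) : ℝ) = Q * (κ * (α ⬝ᵥ scaledPoint Q v)) := by
      intro c κ hcκ v
      have := dotProduct_scaledPoint Q c v
      rw [hcκ, smul_dotProduct, smul_eq_mul] at this
      rw [this]
      field_simp
    have hc0 : c ≠ 0 := by
      rintro rfl
      refine hα ?_
      have h1 : κ • α = 0 := by
        rw [← hcκ]
        ext
        simp
      exact (smul_eq_zero.1 h1).resolve_left hκ.ne'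
    have hmem : c ∈ normals (List.ofFn V) := by
      refine mem_normals.2 ⟨fun j => (V (i j), u j, u' j),
        fun j => ⟨List.mem_ofFn.2 ⟨i j, rfl⟩, hu j, hu' j⟩, hcT, hc0, fun j w hw => ?_⟩
      have : ((c ⬝ᵥ w : ℤ) : ℝ) ≤ (c ⬝ᵥ u j : ℤ) := by
        rw [hdot c κ hcκ, hdot c κ hcκ, h j]
        have := hle (i j) w hw
        gcongr
      exact_mod_cast this
    obtain ⟨c', hc', hcc'⟩ := exists_sameDir_mem_pwFilter hmem hc0
    obtain ⟨b, hb, hbc⟩ := (sameDir_iff hc0).1 hcc'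
    have hc'κ : (fun l => (c' l : ℝ)) = (b * κ) • α := by
      ext l
      rw [hbc, mul_smul, ← hcκ]
      rfl
    have hc'0 : c' ≠ 0 := (mem_normals.1 (List.pwFilter_subset _ hc')).choose_spec.2.2.1
    refine ⟨normalIneq Q V c', List.mem_append_right _ (List.mem_map.2 ⟨c', hc', rfl⟩), ?_⟩
    refine hf.exists_pos_smul hdim hE (valid_normalIneq hQ c') (normalIneq_ne_zero hQ hc'0)
      (fun x hx => hface _ _ (fun j v hv hvt => ?_) x hx)
    rw [normalIneq_apply hQ, sub_eq_self, Int.cast_eq_zero, sub_eq_zero]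
    refine le_antisymm ?_ (dotProduct_le_support c' hv)
    obtain ⟨v', hv', hv's⟩ := exists_dotProduct_eq_support c' (hne j)
    rw [← hv's]
    have : ((c' ⬝ᵥ v' : ℤ) : ℝ) ≤ (c' ⬝ᵥ v : ℤ) := by
      rw [hdot c' _ hc'κ, hdot c' _ hc'κ, (htight j v hv).1 hvt]
      have := hle j v' hv'
      gcongr
    exact_mod_cast this

theorem isFacetSystem_facetSystem (hne : ∀ i, V i ≠ [])
    (hfull : ∀ i (w : Fin (e + 1) → ℝ) (γ : ℝ), (∀ u ∈ V i, w ⬝ᵥ scaledPoint Q u = γ) → w = 0)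
    (hQ : 0 < Q) (hn : 1 ≤ n) :
    IsFacetSystem (convexHull ℝ (liftedPoints Q V)) (facetSystem Q V) := by
  have hdim := polyDim_liftedPoints hne hfull
  have hE := one_le_finrank (d := e + 1) hn
  have hdesc : ∀ r ∈ facetSystem Q V,
      DescribesFacet (convexHull ℝ (liftedPoints Q V)) r.lhs (r.ρ : ℝ) := by
    intro r hr
    rcases List.mem_append.1 hr with hr | hr
    · obtain ⟨i, rfl⟩ := List.mem_ofFn.1 hr
      exact describesFacet_simplexIneq hne hfull hn i
    · obtain ⟨c, hc, rfl⟩ := List.mem_map.1 hr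
      exact describesFacet_of_mem_normals hne hfull hQ hn (List.pwFilter_subset _ hc)
  have hne0 : ∀ c ∈ (normals (List.ofFn V)).pwFilter (fun c c' => ¬SameDir c c'), c ≠ 0 :=
    fun c hc => (mem_normals.1 (List.pwFilter_subset _ hc)).choose_spec.2.2.1
  refine ⟨hdesc, ?_, ?_, ?_⟩
  · rintro F ⟨f, β, hf, rfl⟩
    obtain ⟨r, hr, a, ha, hra, hρ⟩ := exists_mem_facetSystem hne hfull hQ hn hf
    refine ⟨r, hr, ?_⟩
    ext x
    simp only [face, Set.mem_ofPred_eq, hra, hρ, LinearMap.smul_apply, smul_eq_mul,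
      mul_right_inj' ha.ne']
  · rw [facetSystem, List.pairwise_append]
    refine ⟨?_, ?_, ?_⟩
    · rw [List.pairwise_ofFn]
      intro i j hij heq
      obtain ⟨u, hu⟩ := List.exists_mem_of_ne_nil _ (hne i)
      have hmem : (scaledPoint Q u, unitVec n i) ∈ face (convexHull ℝ (liftedPoints Q V))
          (simplexIneq (e + 1) j).lhs (simplexIneq (n := n) (e + 1) j).ρ :=
        ⟨subset_convexHull ℝ _ (mem_liftedPoints hu), by
          rw [simplexIneq_apply, if_neg hij.ne, sub_zero]⟩
      -- Layer `i` lies on the face of inequality `j` but has slack `1` in inequality `i`.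
      rw [← heq] at hmem
      have := hmem.2
      rw [simplexIneq_apply, if_pos rfl] at this
      linarith
    · rw [List.pairwise_map]
      refine (List.pairwise_pwFilter _).imp_of_mem fun {c c'} hc hc' hcc' heq => hcc' ?_
      -- Equal facets have positively proportional inequalities, so the two normals would have the
      -- same direction.
      obtain ⟨a, ha, hac, -⟩ := (hdesc _ (List.mem_append_right _
        (List.mem_map.2 ⟨c, hc, rfl⟩))).exists_pos_smul hdim hE (valid_normalIneq hQ c')
        (normalIneq_ne_zero hQ (hne0 c' hc')) fun x hx => (heq ▸ hx).2
      rw [lhs_eq_functional, lhs_eq_functional, functional_smul, functional_inj] at hac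
      refine (sameDir_iff (hne0 c hc)).2 ⟨a, ha, fun j => ?_⟩
      have hQ' : (Q : ℝ) ≠ 0 := by exact_mod_cast hQ.ne'
      have := congrFun hac.1 j
      simp only [normalIneq, Int.cast_mul, Pi.smul_apply, smul_eq_mul] at this
      refine mul_left_cancel₀ hQ' ?_
      rw [this]
      ring
    · intro r hr r' hr' heq
      obtain ⟨i, rfl⟩ := List.mem_ofFn.1 hr
      obtain ⟨c, hc, rfl⟩ := List.mem_map.1 hr'
      obtain ⟨a, ha, hac, -⟩ := (hdesc _ (List.mem_append_left _ hr)).exists_pos_smul hdim hE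
        (valid_normalIneq hQ c) (normalIneq_ne_zero hQ (hne0 c hc)) fun x hx => (heq ▸ hx).2
      rw [lhs_eq_functional, lhs_eq_functional, functional_smul, functional_inj] at hac
      -- A simplex inequality has zero `x`-part, whereas the `x`-part of the other is `Q • c` with
      -- `c ≠ 0`.
      refine hne0 c hc (funext fun j => ?_)
      have := congrFun hac.1 j
      simpa [normalIneq, simplexIneq, hQ.ne'] using this
  · refine subset_antisymm (fun p hp => ?_) fun p hp r hr => (hdesc r hr).1 p hp
    by_contra hpS
    obtain ⟨f, β, hf, hlt⟩ := exists_describesFacet_lt finite_liftedPoints hdim hE hpS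
    obtain ⟨r, hr, a, ha, hra, hρ⟩ := exists_mem_facetSystem hne hfull hQ hn hf
    have := hp r hr
    rw [hra, hρ, LinearMap.smul_apply, smul_eq_mul] at this
    exact absurd (le_of_mul_le_mul_left this ha) (not_le.2 hlt)

end
-- From the encoded input to the list algorithm
/-- The rows of an input as a list of lists. -/
def Input.toLists {d n : ℕ} (I : Input d n) : List (List ((Fin d → ℚ) × ℚ)) :=
  List.ofFn fun i => List.ofFn fun k => (I.A i k, I.b i k)

/-- The type of nested lists does not mention `n` or the numbers of rows, so one polynomial-time
function covers all inputs. -/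
theorem Input.enc_toLists {d n : ℕ} (I : Input d n) : enc I.toLists = I.encode := by
  simp only [Input.toLists, Input.encode, enc, Val.ofTuple, List.map_ofFn, Function.comp_def]

/-- An inequality with its coefficients of `z` as a list. -/
def Ineq.toTriple {d n : ℕ} (r : Ineq d n) : (Fin d → ℤ) × List ℤ × ℤ :=
  (r.α, List.ofFn r.μ, r.ρ)

theorem Ineq.enc_toTriple {d n : ℕ} (r : Ineq d n) : enc r.toTriple = r.encode := by
  simp only [Ineq.toTriple, Ineq.encode, enc, Val.ofTuple, List.map_ofFn]
  rfl

theorem enc_map_toTriple {d n : ℕ} (R : List (Ineq d n)) :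
    enc (R.map Ineq.toTriple) = Val.ofList (R.map Ineq.encode) := by
  have : enc ∘ Ineq.toTriple = Ineq.encode (d := d) (n := n) := funext Ineq.enc_toTriple
  rw [← this, ← List.map_map]
  rfl

theorem descending_eq_ofFn (n : ℕ) : descending n = List.ofFn fun k : Fin n => (n : ℤ) - (k : ℕ) := by
  induction n with
  | zero => rfl
  | succ n ih =>
    rw [descending, ih, List.ofFn_succ]
    simp

theorem map_toTriple_simplexIneq (d n : ℕ) :
    (List.ofFn (simplexIneq d (n := n))).map Ineq.toTriple = simplexIneqs d (descending n) := by
  rw [descending_eq_ofFn, simplexIneqs, List.ofFn_succ, List.map_cons, List.map_ofFn, List.map_ofFn,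
    List.map_ofFn]
  congr 1
  congr 1
  ext1 k
  simp only [Function.comp, Ineq.toTriple, simplexIneq, List.map_ofFn, Fin.cases_succ,
    Fin.succ_ne_zero, if_false, Prod.mk.injEq]
  refine ⟨rfl, ?_, trivial⟩
  congr 1
  ext1 l
  -- The labels are distinct, so comparing labels amounts to comparing indices.
  have : (n : ℤ) - (k : ℕ) = n - (l : ℕ) ↔ k = l := by
    rw [Fin.ext_iff]
    omega
  simp only [Function.comp, this]

theorem toTriple_normalIneq {d n : ℕ} (Q : ℤ) (V : Fin (n + 1) → List (Fin d → ℤ)) (c : Fin d → ℤ) :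
    (normalIneq Q V c).toTriple = supportIneq Q (List.ofFn V) c := by
  simp [Ineq.toTriple, normalIneq, supportIneq, List.ofFn_succ, List.map_ofFn, Function.comp_def]

/-- The list of scaled vertices of the polyhedron `P i`. -/
def Input.points {d n : ℕ} (I : Input d n) (i : Fin (n + 1)) : List (Fin d → ℤ) :=
  (vertexList (List.ofFn fun k => homRow (I.A i k, I.b i k))).map
    (rescale (denominators (vertexLists I.toLists)))

theorem vertexLists_toLists {d n : ℕ} (I : Input d n) : vertexLists I.toLists =
    List.ofFn fun i => vertexList (List.ofFn fun k => homRow (I.A i k, I.b i k)) := by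
  simp [vertexLists, Input.toLists, List.map_ofFn, Function.comp_def]

theorem pointLists_toLists {d n : ℕ} (I : Input d n) :
    pointLists (vertexLists I.toLists) = List.ofFn I.points := by
  rw [pointLists]
  conv_lhs => rw [vertexLists_toLists, List.map_ofFn]
  rw [← vertexLists_toLists]
  rfl

theorem facetIneqs_toLists {e n : ℕ} (I : Input (e + 1) n) : facetIneqs I.toLists =
    (facetSystem (denominators (vertexLists I.toLists)).prod I.points).map Ineq.toTriple := by
  have hlen : I.toLists.tail.length = n := by simp [Input.toLists]
  rw [facetIneqs, facetSystem, List.map_append, map_toTriple_simplexIneq, hlen,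
    pointLists_toLists, List.map_map]
  congr 2
  ext1 c
  exact (toTriple_normalIneq _ _ c).symm

theorem Input.P_eq_homPolyhedron {d n : ℕ} (I : Input d n) (i : Fin (n + 1)) :
    I.P i = homPolyhedron (List.ofFn fun k => homRow (I.A i k, I.b i k)) := by
  ext x
  simp only [Input.P, homPolyhedron, Set.mem_ofPred_eq, List.forall_mem_ofFn_iff, homRow_le_iff]

theorem vertexList_zero_pos {d : ℕ} {rows : List (Fin (d + 1) → ℤ)} {y : Fin (d + 1) → ℤ}
    (hy : y ∈ vertexList rows) : 0 < y 0 :=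
  (of_decide_eq_true (List.mem_filter.1 hy).2).1

theorem Input.denominators_prod_pos {d n : ℕ} (I : Input d n) :
    0 < (denominators (vertexLists I.toLists)).prod := by
  refine DisjHull.denominators_prod_pos fun V hV y hy => ?_
  rw [vertexLists_toLists] at hV
  obtain ⟨i, rfl⟩ := List.mem_ofFn.1 hV
  exact vertexList_zero_pos hy

theorem Input.P_eq_convexHull {d n : ℕ} (I : Input d n) (i : Fin (n + 1))
    (hb : Bornology.IsBounded (I.P i)) : I.P i = convexHull ℝ
      (scaledPoint (denominators (vertexLists I.toLists)).prod '' {u | u ∈ I.points i}) := by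
  rw [I.P_eq_homPolyhedron] at hb ⊢
  rw [homPolyhedron_eq_convexHull hb]
  congr 1
  have h : ∀ y ∈ vertexList (List.ofFn fun k => homRow (I.A i k, I.b i k)),
      scaledPoint (denominators (vertexLists I.toLists)).prod
        (rescale (denominators (vertexLists I.toLists)) y) = dehom y := fun y hy => by
    refine rescale_eq ?_ hy (vertexList_zero_pos hy) I.denominators_prod_pos
    rw [vertexLists_toLists]
    exact List.mem_ofFn.2 ⟨i, rfl⟩
  ext x
  simp only [Input.points, Set.mem_image, Set.mem_ofPred_eq, List.mem_map]
  constructor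
  · rintro ⟨y, hy, rfl⟩
    exact ⟨_, ⟨y, hy, rfl⟩, h y hy⟩
  · rintro ⟨_, ⟨y, hy, rfl⟩, rfl⟩
    exact ⟨y, hy, (h y hy).symm⟩

theorem Input.D_eq_convexHull {d n : ℕ} (I : Input d n)
    (hb : ∀ i, Bornology.IsBounded (I.P i)) : I.D = convexHull ℝ
      (liftedPoints (denominators (vertexLists I.toLists)).prod I.points) := by
  rw [Input.D]
  refine subset_antisymm (convexHull_min ?_ (convex_convexHull ℝ _)) (convexHull_mono ?_)
  · refine Set.iUnion_subset fun i => ?_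
    rintro _ ⟨x, hx, rfl⟩
    rw [I.P_eq_convexHull i (hb i)] at hx
    -- For fixed `i` the slice of the hull over `e i` is convex and contains the points of layer
    -- `i`, hence all of `P i`.
    refine convexHull_min (t := {x | (x, unitVec n i) ∈ convexHull ℝ
      (liftedPoints (denominators (vertexLists I.toLists)).prod I.points)}) ?_ ?_ hx
    · rintro _ ⟨u, hu, rfl⟩
      exact subset_convexHull ℝ _ (mem_liftedPoints hu)
    · intro x hx y hy a b ha hb hab
      have := convex_convexHull ℝ _ hx hy ha hb hab
      rwa [Prod.smul_mk, Prod.smul_mk, Prod.mk_add_mk, ← add_smul, hab, one_smul] at this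
  · refine forall_mem_liftedPoints.2 fun i u hu => Set.mem_iUnion.2 ⟨i, scaledPoint _ u, ?_, rfl⟩
    rw [I.P_eq_convexHull i (hb i)]
    exact subset_convexHull ℝ _ ⟨u, hu, rfl⟩

theorem Input.isFacetSystem {e n : ℕ} (hn : 1 ≤ n) (I : Input (e + 1) n)
    (hb : ∀ i, Bornology.IsBounded (I.P i)) (hdim : ∀ i, polyDim (I.P i) = ((e + 1 : ℕ) : ℤ)) :
    IsFacetSystem I.D (facetSystem (denominators (vertexLists I.toLists)).prod I.points) := by
  rw [I.D_eq_convexHull hb]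
  have hP : ∀ i, (I.P i).Nonempty := by
    intro i
    by_contra h
    have h' := hdim i
    rw [Set.not_nonempty_iff_eq_empty.1 h, polyDim, if_pos rfl] at h'
    omega
  refine isFacetSystem_facetSystem (fun i h => ?_) (fun i w γ hw => ?_) I.denominators_prod_pos hn
  · have hx := hP i
    rw [I.P_eq_convexHull i (hb i), convexHull_nonempty_iff] at hx
    obtain ⟨_, u, hu, -⟩ := hx
    rw [h] at hu
    exact absurd hu (List.not_mem_nil)
  · have h := (polyDim_eq_finrank_iff (hP i)).1 (by rw [hdim i, Module.finrank_fin_fun])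
      (dotProductEquiv ℝ _ w) γ
    rw [I.P_eq_convexHull i (hb i)] at h
    have h0 := h (eq_on_convexHull (by
      rintro _ ⟨u, hu, rfl⟩
      exact hw u hu))
    simpa using h0

end DisjHull

open DisjHull in
theorem mainTheorem5 (d : ℕ) (hd : 1 ≤ d) :
    ∃ (prog : Prog) (time : Polynomial ℕ),
      ∀ (n : ℕ) (_ : 1 ≤ n) (I : Input d n)
        (_ : ∀ i, Bornology.IsBounded (I.P i))
        (_ : ∀ i, polyDim (I.P i) = (d : ℤ)),
        ∃ (R : List (Ineq d n)) (t : ℕ),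
          Runs prog I.encode (Val.ofList (R.map Ineq.encode)) t ∧
          t ≤ time.eval I.encode.size ∧
          IsFacetSystem I.D R := by
  -- A normal in dimension `d` is a cross product of `e = d - 1` vectors.
  obtain ⟨e, rfl⟩ : ∃ e, d = e + 1 := ⟨d - 1, by omega⟩
  obtain ⟨prog, T, ⟨time, htime⟩, h⟩ := polyTime_facetIneqs (e := e)
  refine ⟨prog, time, fun n hn I hb hdim => ?_⟩
  obtain ⟨t, ht, hr⟩ := h I.toLists
  have hT := ht.trans (htime I.toLists)
  rw [I.enc_toLists] at hr hT
  rw [facetIneqs_toLists, enc_map_toTriple] at hr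
  exact ⟨_, t, hr, hT, I.isFacetSystem hn hb hdim⟩
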